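/- Let $(X,\mu)$ be a standard probability space and let $G$ be a Borel graph on $X$, i.e. a simple undirected graph on $X$ whose edge relation is a Borel subset of $X^2$; write $x\sim y$ for adjacency. Assume that $G$ has bounded degree (there is $d\in\mathbb N$ such that $\mu$-almost every vertex has at most $d$ neighbors) and that $G$ is pmp: every Borel bijection between Borel subsets of $X$ that moves each point of its domain within its connected component of $G$ preserves $\mu$. Let $T_G$ be the adjacency operator on the complex Hilbert space $L^2(X,\mu)$, $$(T_Gf)(x)=\sum_{y\sim x}f(y),$$ and let $M(T_G)=\sup_{f\neq 0}\frac{\langle T_Gf,f\rangle}{\langle f,f\rangle}$. Let $\chi^{\mathrm{ap}}_\mu(G)$ be the approximate $\mu$-measurable chromatic number, i.e. the least $k\in\mathbb N$ such that for every $\varepsilon>0$ there is a Borel set $A\subseteq X$ with $\mu(A)>1-\varepsilon$ for which the induced subgraph $G\restriction A$ has a $\mu$-measurable proper $k$-coloring. Then $T_G$ is a well-defined bounded self-adjoint operator, $M(T_G)$ is the maximum of its spectrum, $\chi^{\mathrm{ap}}_\mu(G)$ is defined (finite), and $$\chi^{\mathrm{ap}}_\mu(G)\le\lfloor M(T_G)\rfloor+1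 .$$ -/

import Mathlib

open MeasureTheory

namespace BorelGraph

variable {X : Type*} [MeasurableSpace X]

/-- A (simple, undirected) graph on `X` is Borel if its edge relation is a Borel subset of `X × X`. -/
def IsBorel (G : SimpleGraph X) : Prop :=
  MeasurableSet {p : X × X | G.Adj p.1 p.2}

/-- Bounded degree, null sets being discarded: some `d : ℕ` bounds the degree of almost every
vertex. -/
def HasBoundedDegree (G : SimpleGraph X) (μ : Measure X) : Prop :=
  ∃ d : ℕ, ∀ᵐ x ∂μ, (G.neighborSet x).encard ≤ d

/-- `G` is `μ`-preserving: every partial Borel bijection `θ : A → θ '' A` whose graph is contained in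
the connectedness relation of `G` satisfies `μ (θ '' B) = μ B` for all Borel `B ⊆ A`. -/
def IsPMP (G : SimpleGraph X) (μ : Measure X) : Prop :=
  ∀ (A : Set X) (θ : X → X), MeasurableSet A → Measurable (fun x : A => θ x) → Set.InjOn θ A →
    (∀ x ∈ A, G.Reachable x (θ x)) →
    ∀ B ⊆ A, MeasurableSet B → μ (θ '' B) = μ B

/-- For every `ε > 0` there is a Borel set `A` with `μ A > 1 - ε` such that the induced subgraph on
`A` has a `μ`-measurable proper `k`-coloring. -/
def ApproxMeasurablyColorable (G : SimpleGraph X) (μ : Measure X) (k : ℕ) : Prop :=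
  ∀ ε : ℝ, 0 < ε → ∃ A : Set X, MeasurableSet A ∧ 1 - ε < μ.real A ∧
    ∃ c : (G.induce A).Coloring (Fin k),
      ∀ i : Fin k, NullMeasurableSet ((↑) '' {x : A | c x = i} : Set X) μ

/-- The approximate `μ`-measurable chromatic number: the least `k` such that `G` is approximately
`μ`-measurably `k`-colorable, and `⊤` if there is no such `k`. -/
noncomputable def approxChromaticNumber (G : SimpleGraph X) (μ : Measure X) : ℕ∞ :=
  ⨅ k ∈ {k : ℕ | ApproxMeasurablyColorable G μ k}, (k : ℕ∞)

/-- `T` is the bounded operator `(T f)(x) = ∑_{y ∼ x} f(y)` on the complex Hilbert space `L²(X, μ)`. -/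
def IsAdjacencyOperator (G : SimpleGraph X) (μ : Measure X)
    (T : Lp ℂ 2 μ →L[ℂ] Lp ℂ 2 μ) : Prop :=
  ∀ f : Lp ℂ 2 μ, T f =ᵐ[μ] fun x => ∑ᶠ y ∈ G.neighborSet x, f y

theorem IsAdjacencyOperator.unique {G : SimpleGraph X} {μ : Measure X}
    {S T : Lp ℂ 2 μ →L[ℂ] Lp ℂ 2 μ} (hS : IsAdjacencyOperator G μ S)
    (hT : IsAdjacencyOperator G μ T) : S = T :=
  ContinuousLinearMap.ext fun f => Lp.ext ((hS f).trans (hT f).symm)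

open Classical in
/-- The adjacency operator of `G`: the unique bounded operator `T` with `IsAdjacencyOperator G μ T`
if there is one, and `0` otherwise. -/
noncomputable def adjacencyOperator (G : SimpleGraph X) (μ : Measure X) :
    Lp ℂ 2 μ →L[ℂ] Lp ℂ 2 μ :=
  if h : ∃ T, IsAdjacencyOperator G μ T then h.choose else 0

theorem IsAdjacencyOperator.eq_adjacencyOperator {G : SimpleGraph X} {μ : Measure X}
    {T : Lp ℂ 2 μ →L[ℂ] Lp ℂ 2 μ} (hT : IsAdjacencyOperator G μ T) :
    adjacencyOperator G μ = T := by
  have h : ∃ T, IsAdjacencyOperator G μ T := ⟨T, hT⟩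
  rw [adjacencyOperator, dif_pos h]
  exact h.choose_spec.unique hT

/-- `M(T) = sup_{f ≠ 0} ⟨T f, f⟩ / ⟨f, f⟩`. -/
noncomputable def maxSpectralValue {H : Type*} [NormedAddCommGroup H] [InnerProductSpace ℂ H]
    (T : H →L[ℂ] H) : ℝ :=
  ⨆ f : {f : H // f ≠ 0}, T.rayleighQuotient f

end BorelGraph

/-! Put `k = ⌊M(T_G)⌋`. For a Borel set `B`, `⟨T_G 1_B, 1_B⟩` is the integral over `B` of the number
of neighbors inside `B`, so `M(T_G) < k + 1` forbids a set of positive measure in which every vertex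
has more than `k` neighbors (`measure_eq_zero_of_lt_ncard_nbrsIn`). Remove all vertices of degree at
most `k`, and repeat. Degrees being finite, every vertex of the limit set keeps more than `k`
neighbors there, so the limit is null and the remainder after `n` steps has measure tending to `0`.
The removed vertices are colored greedily, last removed first: each meets at most `k` earlier
neighbors, so `k + 1` colors suffice. A countable Borel coloring orders the vertices removed at the
same step.

The operator rests on mass transport: the measure on oriented edges is invariant under reversal
(`map_swap_edgeMeasure`), which yields boundedness and self-adjointness. The pmp hypothesis concerns
only injective maps, whereas a choice of neighbor need not even be countable-to-one, since a null
set of vertices may have infinite degree. `IsPMP.exists_injOn_pieces` settles this: where the fibre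
measures have no atoms, a Borel injection along the fibres would halve the measure, contradicting
pmp; the remaining points are atoms of their fibres and split into countably many injective pieces.
-/

namespace BorelGraph

/-! ### Rayleigh quotients and the top of the spectrum -/

section Spectrum

variable {H : Type*} [NormedAddCommGroup H] [InnerProductSpace ℂ H]

theorem bddAbove_range_rayleighQuotient (T : H →L[ℂ] H) :
    BddAbove (Set.range fun f : {f : H // f ≠ 0} => T.rayleighQuotient f) := by
  refine ⟨‖T‖, ?_⟩
  rintro _ ⟨f, rfl⟩
  exact (le_abs_self _).trans (T.rayleighQuotient_le_norm f)

theorem re_inner_le_maxSpectralValue_mul (T : H →L[ℂ] H) (f : H) :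
    (inner ℂ (T f) f).re ≤ maxSpectralValue T * ‖f‖ ^ 2 := by
  rcases eq_or_ne f 0 with rfl | hf
  · simp
  · have h := le_ciSup (bddAbove_range_rayleighQuotient T) ⟨f, hf⟩
    have hpos : 0 < ‖f‖ ^ 2 := by positivity
    exact (div_le_iff₀ hpos).1 h

/-- The supremum of the Rayleigh quotients of a self-adjoint operator is the maximum of its
spectrum. -/
theorem maxSpectralValue_isGreatest_spectrum [CompleteSpace H] [Nontrivial H] {T : H →L[ℂ] H}
    (hT : IsSelfAdjoint T) :
    IsGreatest {r : ℝ | (r : ℂ) ∈ spectrum ℂ T} (maxSpectralValue T) := by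
  have hset : {r : ℝ | (r : ℂ) ∈ spectrum ℂ T} = spectrum ℝ T := by
    ext r
    exact (spectrum.algebraMap_mem_iff ℂ (R := ℝ) (a := T) (r := r))
  -- Both conditions say that `r - T` is a positive operator, so the spectrum and the Rayleigh
  -- quotients have the same upper bounds.
  have hle (r : ℝ) : (∀ x ∈ spectrum ℝ T, x ≤ r) ↔ maxSpectralValue T ≤ r := by
    rw [← le_algebraMap_iff_spectrum_le hT, ContinuousLinearMap.le_def,
      ContinuousLinearMap.isPositive_def']
    have hsa : IsSelfAdjoint (algebraMap ℝ (H →L[ℂ] H) r - T) :=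
      (IsSelfAdjoint.algebraMap _ (IsSelfAdjoint.all r)).sub hT
    have hval (f : H) : (algebraMap ℝ (H →L[ℂ] H) r - T).reApplyInnerSelf f =
        r * ‖f‖ ^ 2 - (inner ℂ (T f) f).re := by
      rw [ContinuousLinearMap.reApplyInnerSelf_apply, Algebra.algebraMap_eq_smul_one]
      simp [inner_sub_left, inner_smul_left_eq_smul, ← Complex.ofReal_pow]
    simp only [hval, hsa, true_and, sub_nonneg]
    constructor
    · intro h
      obtain ⟨f, hf⟩ := exists_ne (0 : H)
      have : Nonempty {f : H // f ≠ 0} := ⟨⟨f, hf⟩⟩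
      refine ciSup_le fun f => ?_
      have hpos : 0 < ‖(f : H)‖ ^ 2 := by
        have := norm_pos_iff.2 f.2
        positivity
      exact (div_le_iff₀ hpos).2 (h f)
    · intro h f
      exact (re_inner_le_maxSpectralValue_mul T f).trans (by gcongr)
  have hne : (spectrum ℝ T).Nonempty := ContinuousFunctionalCalculus.spectrum_nonempty T hT
  obtain ⟨m, hm, hmax⟩ := (spectrum.isCompact (𝕜 := ℝ) T).exists_isGreatest hne
  rw [hset]
  have : maxSpectralValue T = m := le_antisymm ((hle m).1 hmax) ((hle _).2 le_rfl m hm)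
  exact this ▸ ⟨hm, hmax⟩

end Spectrum

/-! ### Borel enumeration of bounded sections -/

section Enumeration

open Set

/-- A set of `n` elements is listed in increasing order of a given injective real function. -/
theorem exists_strictMono_of_encard_eq {β : Type*} {ι : β → ℝ} (hι : Function.Injective ι)
    {S : Set β} {n : ℕ} (hS : S.encard = n) :
    ∃ v : Fin n → β, StrictMono (ι ∘ v) ∧ ∀ i, v i ∈ S := by
  classical
  have hfin : S.Finite := finite_of_encard_eq_coe hS
  have hcard : (hfin.toFinset.image ι).card = n := by
    rw [Finset.card_image_of_injective _ hι]
    have := hfin.encard_eq_coe_toFinset_card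
    rw [hS] at this
    exact_mod_cast this.symm
  have h (i : Fin n) : ∃ y ∈ S, ι y = (hfin.toFinset.image ι).orderEmbOfFin hcard i := by
    have := Finset.orderEmbOfFin_mem (hfin.toFinset.image ι) hcard i
    rw [Finset.mem_image] at this
    obtain ⟨y, hy, hy'⟩ := this
    exact ⟨y, hfin.mem_toFinset.1 hy, hy'⟩
  choose v hv hv' using h
  refine ⟨v, fun i j hij => ?_, hv⟩
  simpa [hv'] using hij

/-- A Borel set whose sections have at most `d` points is the union of `d` graphs of partial Borel
functions, which are pairwise disjoint. -/
theorem exists_enumeration_of_encard_le {α β : Type*} [MeasurableSpace α] [StandardBorelSpace α]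
    [MeasurableSpace β] [StandardBorelSpace β] [Nonempty β] (d : ℕ) :
    ∀ E : Set (α × β), MeasurableSet E → (∀ x, {y | (x, y) ∈ E}.encard ≤ d) →
      ∃ (A : Fin d → Set α) (θ : Fin d → α → β), (∀ i, MeasurableSet (A i)) ∧
        (∀ i, Measurable (θ i)) ∧ (∀ x y, (x, y) ∈ E ↔ ∃ i, x ∈ A i ∧ θ i x = y) ∧
        ∀ x i j, x ∈ A i → x ∈ A j → θ i x = θ j x → i = j := by
  classical
  induction d with
  | zero =>
    intro E _ hd
    refine ⟨fun i => i.elim0, fun i => i.elim0, fun i => i.elim0, fun i => i.elim0, ?_,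
      fun _ i => i.elim0⟩
    intro x y
    have := hd x
    simp only [Nat.cast_zero, nonpos_iff_eq_zero, encard_eq_zero] at this
    have hxy : (x, y) ∉ E := fun h => (this ▸ h : y ∈ (∅ : Set β))
    simp [hxy]
  | succ d ih =>
    intro E hE hd
    obtain ⟨ι, hι⟩ := exists_measurableEmbedding_real β
    -- An increasing listing of a full section of `d + 1` points is determined by that section, so
    -- `P` projects injectively to `α`. By Lusin–Souslin its projection `D` is Borel and the listing
    -- is a Borel function on it; off `D` the sections have at most `d` points.
    let P : Set (α × (Fin (d + 1) → β)) :=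
      {p | StrictMono (ι ∘ p.2) ∧ ∀ i, (p.1, p.2 i) ∈ E}
    have hP : MeasurableSet P := by
      have : P = (⋂ i, ⋂ j, {p | i < j → ι (p.2 i) < ι (p.2 j)}) ∩ ⋂ i, {p | (p.1, p.2 i) ∈ E} := by
        ext p
        simp [P, StrictMono]
      rw [this]
      refine (MeasurableSet.iInter fun i => MeasurableSet.iInter fun j => ?_).inter
        (MeasurableSet.iInter fun i => ?_)
      · by_cases hij : i < j
        · simp only [hij, true_imp_iff]
          exact measurableSet_lt (hι.measurable.comp (measurable_pi_apply i |>.comp measurable_snd))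
            (hι.measurable.comp (measurable_pi_apply j |>.comp measurable_snd))
        · simp [hij]
      · exact (measurable_fst.prodMk ((measurable_pi_apply i).comp measurable_snd)) hE
    have hrange {x : α} {v : Fin (d + 1) → β} (h : (x, v) ∈ P) : range v = {y | (x, y) ∈ E} := by
      have hsub : range v ⊆ {y | (x, y) ∈ E} := by
        rintro _ ⟨i, rfl⟩
        exact h.2 i
      have hcard : (range v).encard = (d + 1 : ℕ) := by
        have hinj : Function.Injective v := h.1.injective.of_comp
        rw [← image_univ, hinj.encard_image, encard_univ]
        simp
      exact (finite_of_encard_eq_coe hcard).eq_of_subset_of_encard_le hsub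
        (hcard ▸ hd x)
    have hinj : Function.Injective fun p : P => p.1.1 := by
      rintro ⟨⟨x, v⟩, hv⟩ ⟨⟨x', w⟩, hw⟩ (rfl : x = x')
      have h1 : range (ι ∘ v) = range (ι ∘ w) := by
        rw [range_comp, range_comp, hrange hv, hrange hw]
      have h2 := (hv.1.range_inj hw.1).1 h1
      have h3 : v = w := hι.injective.comp_left h2
      simp [h3]
    have : StandardBorelSpace P := hP.standardBorel
    have hemb : MeasurableEmbedding fun p : P => p.1.1 :=
      (measurable_fst.comp measurable_subtype_coe).measurableEmbedding hinj
    obtain ⟨v, hvm, hv⟩ := hemb.exists_measurable_extend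
      (measurable_snd.comp measurable_subtype_coe) (fun _ => inferInstance)
    let D : Set α := range fun p : P => p.1.1
    have hD : MeasurableSet D := hemb.measurableSet_range
    have hvD {x : α} (hx : x ∈ D) : (x, v x) ∈ P := by
      obtain ⟨⟨⟨x, w⟩, hw⟩, rfl⟩ := hx
      have := congrFun hv ⟨⟨x, w⟩, hw⟩
      simp only [Function.comp] at this
      simpa [this] using hw
    obtain ⟨A, θ, hA, hθ, henum, hdist⟩ := ih (E \ (Prod.fst ⁻¹' D))
      (hE.diff (measurable_fst hD)) (fun x => by
        by_cases hx : x ∈ D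
        · simp [hx]
        · have hne : {y | (x, y) ∈ E}.encard ≠ (d + 1 : ℕ) := fun h => by
            obtain ⟨w, hw, hw'⟩ := exists_strictMono_of_encard_eq hι.injective h
            exact hx ⟨⟨(x, w), hw, hw'⟩, rfl⟩
          have hlt := lt_of_le_of_ne (hd x) hne
          have : {y | (x, y) ∈ E \ (Prod.fst ⁻¹' D)} = {y | (x, y) ∈ E} := by
            ext y
            simp [hx]
          rw [this]
          exact Order.le_of_lt_add_one (by exact_mod_cast hlt))
    have hAD {x : α} {i : Fin d} (hx : x ∈ A i) : x ∉ D :=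
      ((henum x (θ i x)).2 ⟨i, hx, rfl⟩).2
    -- Over `D` all indices follow the listing `v`; off `D` the first `d` follow the inductive
    -- enumeration and the last one is undefined.
    refine ⟨fun i => Fin.lastCases D (fun i => D ∪ A i) i,
      fun i => Fin.lastCases (fun x => v x (Fin.last d))
        (fun i => D.piecewise (fun x => v x i.castSucc) (θ i)) i, ?_, ?_, ?_, ?_⟩
    · intro i
      refine Fin.lastCases ?_ (fun i => ?_) i
      · simpa using hD
      · simpa using hD.union (hA i)
    · intro i
      refine Fin.lastCases ?_ (fun i => ?_) i
      · simpa using measurable_pi_iff.1 hvm _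
      · simpa using Measurable.piecewise hD (measurable_pi_iff.1 hvm _) (hθ i)
    · intro x y
      rw [Fin.exists_fin_succ']
      by_cases hx : x ∈ D
      · have := hrange (hvD hx)
        have hy : (x, y) ∈ E ↔ y ∈ range (v x) := by rw [this]; rfl
        rw [hy, mem_range, Fin.exists_fin_succ']
        simp [hx]
      · have := henum x y
        simp only [mem_sdiff, mem_preimage, hx, not_false_iff, and_true] at this
        simp [hx, this]
    · intro x i j
      by_cases hx : x ∈ D
      · have hinj : Function.Injective (v x) := (hvD hx).1.injective.of_comp
        refine Fin.lastCases ?_ (fun i => ?_) i <;> refine Fin.lastCases ?_ (fun j => ?_) j <;>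
          simp [hx, hinj.eq_iff]
      · refine Fin.lastCases ?_ (fun i => ?_) i <;> refine Fin.lastCases ?_ (fun j => ?_) j <;>
          simp [hx]
        exact hdist x i j

end Enumeration

/-! ### Compressing atomless fibres to half their measure -/

section Halving

open Set Filter Topology ProbabilityTheory

theorem continuous_real_Iic (m : Measure ℝ) [IsFiniteMeasure m] [NullSingletonClass m] :
    Continuous fun t => m.real (Iic t) := by
  have h : (fun t => m.real (Iic t)) = fun t => m.real (Iic 0) + ∫ _ in (0 : ℝ)..t, (1 : ℝ) ∂m := by
    funext t
    rw [← intervalIntegral.integral_Iic_sub_Iic (integrable_const _).integrableOn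
      (integrable_const _).integrableOn]
    simp
  rw [h]
  exact continuous_const.add
    (intervalIntegral.continuous_primitive (fun _ _ => intervalIntegrable_const) 0)

theorem tendsto_real_Iic_atBot (m : Measure ℝ) [IsFiniteMeasure m] :
    Tendsto (fun t => m.real (Iic t)) atBot (𝓝 0) := by
  have h := tendsto_measure_iInter_atBot (μ := m) (s := fun t : ℝ => Iic t)
    (fun t => measurableSet_Iic.nullMeasurableSet) (fun a b hab => Iic_subset_Iic.2 hab)
    ⟨0, measure_ne_top _ _⟩
  rw [iInter_Iic_eq_empty_iff.2 (by simp), measure_empty] at h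
  exact (ENNReal.tendsto_toReal ENNReal.zero_ne_top).comp h

theorem tendsto_real_Iic_atTop (m : Measure ℝ) [IsFiniteMeasure m] :
    Tendsto (fun t => m.real (Iic t)) atTop (𝓝 (m.real univ)) :=
  (ENNReal.tendsto_toReal (measure_ne_top m univ)).comp (tendsto_measure_Iic_atTop m)

/-- The probability integral transform, for finite measures without atoms. -/
theorem map_real_Iic (m : Measure ℝ) [IsFiniteMeasure m] [NullSingletonClass m] :
    m.map (fun t => m.real (Iic t)) = volume.restrict (Icc 0 (m.real univ)) := by
  have hcont := continuous_real_Iic m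
  have hmono : Monotone fun t => m.real (Iic t) := fun a b hab =>
    measureReal_mono (Iic_subset_Iic.2 hab)
  have hle (t : ℝ) : m.real (Iic t) ≤ m.real univ := measureReal_mono (subset_univ _)
  refine Measure.ext_of_Iic _ _ fun a => ?_
  rw [Measure.map_apply hcont.measurable measurableSet_Iic,
    Measure.restrict_apply measurableSet_Iic]
  rcases lt_or_ge a 0 with ha | ha
  · have h1 : (fun t => m.real (Iic t)) ⁻¹' Iic a = ∅ := by
      ext t
      simpa using ha.trans_le measureReal_nonneg
    have h2 : Iic a ∩ Icc 0 (m.real univ) = ∅ := by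
      ext t
      simp only [mem_inter_iff, mem_Iic, mem_Icc, mem_empty_iff_false, iff_false]
      rintro ⟨h, h', -⟩
      linarith
    rw [h1, h2, measure_empty, measure_empty]
  rcases le_or_gt (m.real univ) a with ham | ham
  · have h1 : (fun t => m.real (Iic t)) ⁻¹' Iic a = univ := by
      ext t
      simpa using (hle t).trans ham
    have h2 : Iic a ∩ Icc 0 (m.real univ) = Icc 0 (m.real univ) :=
      inter_eq_right.2 fun t ht => ht.2.trans ham
    rw [h1, h2, Real.volume_Icc, sub_zero, ofReal_measureReal]
  have h2 : Iic a ∩ Icc 0 (m.real univ) = Icc 0 a := by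
    ext t
    simp only [mem_inter_iff, mem_Iic, mem_Icc]
    constructor
    · rintro ⟨h, h', -⟩
      exact ⟨h', h⟩
    · rintro ⟨h, h'⟩
      exact ⟨h', h, h'.trans ham.le⟩
  rw [h2, Real.volume_Icc, sub_zero]
  set S := (fun t => m.real (Iic t)) ⁻¹' Iic a with hS
  rcases S.eq_empty_or_nonempty with hempty | hne
  · have hpos (t : ℝ) : a ≤ m.real (Iic t) := by
      have : t ∉ S := by simp [hempty]
      exact le_of_lt (by simpa [hS] using this)
    have : a ≤ 0 := ge_of_tendsto' (tendsto_real_Iic_atBot m) hpos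
    simp [hempty, le_antisymm this ha]
  · have hbdd : BddAbove S := by
      obtain ⟨b, hb⟩ := ((tendsto_real_Iic_atTop m).eventually (lt_mem_nhds ham)).exists
      refine ⟨b, fun t ht => ?_⟩
      by_contra hlt
      exact absurd (hb.trans_le (hmono (not_le.1 hlt).le)) (not_lt.2 ht)
    have hclosed : IsClosed S := isClosed_Iic.preimage hcont
    have hmem : sSup S ∈ S := hclosed.csSup_mem hne hbdd
    have hSeq : S = Iic (sSup S) := by
      ext t
      exact ⟨fun ht => le_csSup hbdd ht, fun ht => (hmono ht).trans hmem⟩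
    -- Beyond `sSup S` the distribution function exceeds `a`; continuity carries the bound back to
    -- `sSup S`.
    have hval : m.real (Iic (sSup S)) = a := by
      refine le_antisymm hmem ?_
      have h : Tendsto (fun t => m.real (Iic t)) (𝓝[>] (sSup S)) (𝓝 (m.real (Iic (sSup S)))) :=
        hcont.continuousAt.tendsto.mono_left nhdsWithin_le_nhds
      refine ge_of_tendsto h ?_
      filter_upwards [self_mem_nhdsWithin] with t ht
      by_contra hlt
      exact absurd (le_csSup hbdd (not_le.1 hlt).le) (not_le.2 ht)
    rw [← hval, ofReal_measureReal, ← hSeq]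

/-- The set is an initial segment of `(q, ∞)`. Near a point with a larger element `t'` it lies in
the null set `Ioc q t'`; near a greatest element `t`, in `Ioc q t`. No atomlessness is required. -/
theorem measure_setOf_Ioc_null (m : Measure ℝ) (q : ℝ) :
    m {t | q < t ∧ m (Ioc q t) = 0} = 0 := by
  refine measure_null_of_locally_null _ fun t ht => ?_
  by_cases h : ∃ t', (q < t' ∧ m (Ioc q t') = 0) ∧ t < t'
  · obtain ⟨t', ht', hlt⟩ := h
    refine ⟨Ioc q t', ?_, ht'.2⟩
    filter_upwards [self_mem_nhdsWithin, nhdsWithin_le_nhds (Iio_mem_nhds hlt)] with s hs hs'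
    exact ⟨hs.1, le_of_lt hs'⟩
  · push Not at h
    refine ⟨Ioc q t, ?_, ht.2⟩
    filter_upwards [self_mem_nhdsWithin] with s hs
    exact ⟨hs.1, h s hs⟩

variable {Z : Type*} [MeasurableSpace Z]

theorem measurable_kernel_Iic (κ : Kernel Z ℝ) [IsFiniteKernel κ] :
    Measurable fun p : Z × ℝ => κ p.1 (Iic p.2) := by
  have : MeasurableSet {p : (Z × ℝ) × ℝ | p.2 ≤ p.1.2} :=
    measurableSet_le measurable_snd measurable_fst.snd
  exact Kernel.measurable_kernel_prodMk_left (κ := κ.prodMkRight ℝ) this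

theorem measurable_kernel_Ioc (κ : Kernel Z ℝ) [IsFiniteKernel κ] (q : ℝ) :
    Measurable fun p : Z × ℝ => κ p.1 (Ioc q p.2) := by
  have : MeasurableSet {p : (Z × ℝ) × ℝ | q < p.2 ∧ p.2 ≤ p.1.2} :=
    (measurableSet_lt measurable_const measurable_snd).inter
      (measurableSet_le measurable_snd measurable_fst.snd)
  exact Kernel.measurable_kernel_prodMk_left (κ := κ.prodMkRight ℝ) this

theorem measurable_kernel_singleton (κ : Kernel Z ℝ) [IsFiniteKernel κ] :
    Measurable fun p : Z × ℝ => κ p.1 {p.2} := by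
  have : MeasurableSet {p : (Z × ℝ) × ℝ | p.2 = p.1.2} :=
    measurableSet_eq_fun measurable_snd measurable_fst.snd
  exact Kernel.measurable_kernel_prodMk_left (κ := κ.prodMkRight ℝ) this

theorem compProd_eq_zero_iff (ν : Measure Z) [SFinite ν] (κ : Kernel Z ℝ) [IsFiniteKernel κ]
    {S : Set (Z × ℝ)} (hS : MeasurableSet S) :
    (ν ⊗ₘ κ) S = 0 ↔ (fun z => κ z (Prod.mk z ⁻¹' S)) =ᵐ[ν] 0 := by
  rw [Measure.compProd_apply hS, lintegral_eq_zero_iff (Kernel.measurable_kernel_prodMk_left hS)]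

/-- The fibrewise distribution function of a kernel on `ℝ`. -/
noncomputable def fiberCDF (κ : Kernel Z ℝ) (p : Z × ℝ) : Z × ℝ :=
  (p.1, (κ p.1).real (Iic p.2))

theorem measurable_fiberCDF (κ : Kernel Z ℝ) [IsFiniteKernel κ] : Measurable (fiberCDF κ) :=
  measurable_fst.prodMk (measurable_kernel_Iic κ).ennreal_toReal

theorem kernel_preimage_fiberCDF (κ : Kernel Z ℝ) [IsFiniteKernel κ] [∀ z, NullSingletonClass (κ z)]
    {S : Set (Z × ℝ)} (hS : MeasurableSet S) (z : Z) :
    κ z (Prod.mk z ⁻¹' (fiberCDF κ ⁻¹' S)) =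
      volume (Prod.mk z ⁻¹' S ∩ Icc 0 ((κ z).real univ)) := by
  have hSz : MeasurableSet (Prod.mk z ⁻¹' S) := measurable_prodMk_left hS
  rw [← Measure.restrict_apply hSz, ← map_real_Iic,
    Measure.map_apply (continuous_real_Iic _).measurable hSz]
  rfl

/-- A fibred measure whose fibres have no atoms is not preserved by fibrewise bijections: some
Borel injection, defined almost everywhere, has an image of at most half the total measure. -/
theorem exists_halving [StandardBorelSpace Z] [Nonempty Z] (ν : Measure Z) [IsFiniteMeasure ν]
    (κ : Kernel Z ℝ) [IsFiniteKernel κ] [∀ z, NullSingletonClass (κ z)] {W : Set (Z × ℝ)}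
    (hW : MeasurableSet W) (hnull : (ν ⊗ₘ κ) Wᶜ = 0) :
    ∃ (A : Set (Z × ℝ)) (σ : Z × ℝ → Z × ℝ), MeasurableSet A ∧ Measurable σ ∧ A ⊆ W ∧
      InjOn σ A ∧ MapsTo σ A W ∧ (∀ p ∈ A, (σ p).1 = p.1) ∧ (ν ⊗ₘ κ) Aᶜ = 0 ∧
      2 * (ν ⊗ₘ κ) (σ '' A) ≤ (ν ⊗ₘ κ) univ := by
  -- Points to the left of which the fibre distribution function is locally constant are discarded.
  -- This costs a null set and makes `fiberCDF κ` injective.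
  let W₁ : Set (Z × ℝ) := W ∩ ⋂ q : ℚ, {p | (q : ℝ) < p.2 → κ p.1 (Ioc (q : ℝ) p.2) ≠ 0}
  have hbad (q : ℚ) : MeasurableSet {p : Z × ℝ | (q : ℝ) < p.2 ∧ κ p.1 (Ioc (q : ℝ) p.2) = 0} :=
    (measurableSet_lt measurable_const measurable_snd).inter
      (measurable_kernel_Ioc κ q (measurableSet_singleton 0))
  have hcompl : W₁ᶜ = Wᶜ ∪ ⋃ q : ℚ, {p | (q : ℝ) < p.2 ∧ κ p.1 (Ioc (q : ℝ) p.2) = 0} := by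
    ext p
    simp only [W₁, mem_compl_iff, mem_inter_iff, mem_iInter, mem_union, mem_iUnion, mem_ofPred_eq]
    push Not
    tauto
  have hW₁ : MeasurableSet W₁ := by
    rw [← MeasurableSet.compl_iff, hcompl]
    exact hW.compl.union (MeasurableSet.iUnion hbad)
  have hW₁null : (ν ⊗ₘ κ) W₁ᶜ = 0 := by
    rw [hcompl]
    refine measure_union_null hnull (measure_iUnion_null fun q => ?_)
    rw [Measure.compProd_apply (hbad q)]
    simp only [preimage_ofPred_eq, measure_setOf_Ioc_null, lintegral_zero]
  have hGm := measurable_fiberCDF κ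
  have hGinj : InjOn (fiberCDF κ) W₁ := by
    have key {z : Z} {s t : ℝ} (ht : (z, t) ∈ W₁) (hst : s < t) :
        (κ z).real (Iic s) ≠ (κ z).real (Iic t) := by
      intro h
      obtain ⟨q, hsq, hqt⟩ := exists_rat_btwn hst
      have hq := mem_iInter.1 ht.2 q hqt
      refine hq (measure_mono_null (Ioc_subset_Ioc_left hsq.le) ?_)
      rw [← Iic_sdiff_Iic, measure_sdiff (Iic_subset_Iic.2 hst.le)
        measurableSet_Iic.nullMeasurableSet (measure_ne_top _ _),
        (measureReal_eq_measureReal_iff (measure_ne_top _ _) (measure_ne_top _ _)).1 h, tsub_self]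
    rintro ⟨z, s⟩ hs ⟨z', t⟩ ht h
    obtain ⟨rfl, h⟩ := Prod.ext_iff.1 h
    rcases lt_trichotomy s t with hst | rfl | hst
    · exact absurd h (key ht hst)
    · rfl
    · exact absurd h.symm (key hs hst)
  have : StandardBorelSpace W₁ := hW₁.standardBorel
  have hemb : MeasurableEmbedding fun p : W₁ => fiberCDF κ p :=
    (hGm.comp measurable_subtype_coe).measurableEmbedding (injOn_iff_injective.1 hGinj)
  obtain ⟨r, hr, hrG⟩ := hemb.exists_measurable_extend measurable_subtype_coe
    (fun _ => inferInstance)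
  have hrG' {p : Z × ℝ} (hp : p ∈ W₁) : r (fiberCDF κ p) = p := congrFun hrG ⟨p, hp⟩
  -- `fiberCDF κ` turns each fibre measure into Lebesgue measure on an interval starting at `0`. The
  -- required map is halving in these coordinates, conjugated back by the inverse `r`.
  let h : Z × ℝ → Z × ℝ := fun p => (p.1, p.2 / 2)
  have hh : Measurable h := measurable_fst.prodMk (measurable_snd.div_const 2)
  have hhinj : Function.Injective h := by
    rintro ⟨z, s⟩ ⟨z', t⟩ hst
    obtain ⟨h1, h2⟩ := Prod.ext_iff.1 hst
    simp only [h] at h1 h2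
    exact Prod.ext h1 (by linarith)
  have hV : MeasurableSet (fiberCDF κ '' W₁) := hW₁.image_of_measurable_injOn hGm hGinj
  set V := fiberCDF κ '' W₁ with hVdef
  have hVnull : (ν ⊗ₘ κ) (fiberCDF κ ⁻¹' Vᶜ) = 0 :=
    measure_mono_null (fun p hp hp' => hp (mem_image_of_mem _ hp')) hW₁null
  -- Halving maps each interval into itself and pulls Lebesgue null sets back to null sets, so
  -- almost every halved point still lies in `V`, where `r` inverts.
  have hVnull' : (ν ⊗ₘ κ) (fiberCDF κ ⁻¹' (h ⁻¹' Vᶜ)) = 0 := by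
    rw [compProd_eq_zero_iff ν κ (hGm (hh hV.compl))]
    rw [compProd_eq_zero_iff ν κ (hGm hV.compl)] at hVnull
    filter_upwards [hVnull] with z hz
    rw [Pi.zero_apply, kernel_preimage_fiberCDF κ hV.compl] at hz
    rw [Pi.zero_apply, kernel_preimage_fiberCDF κ (hh hV.compl)]
    have hq : Measure.QuasiMeasurePreserving (fun u : ℝ => u / 2) volume volume := by
      have : (fun u : ℝ => u / 2) = fun u => (2⁻¹ : ℝ) • u := by
        funext u
        simp [div_eq_inv_mul]
      rw [this]
      exact (Measure.quasiMeasurePreserving_smul volume (by norm_num : (2⁻¹ : ℝ) ≠ 0))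
    refine measure_mono_null ?_ (hq.preimage_null hz)
    rintro u ⟨hu, hu0, hum⟩
    exact ⟨hu, by positivity, by linarith⟩
  have hspec {p : Z × ℝ} (hp : fiberCDF κ p ∈ h ⁻¹' V) :
      r (h (fiberCDF κ p)) ∈ W₁ ∧ fiberCDF κ (r (h (fiberCDF κ p))) = h (fiberCDF κ p) := by
    obtain ⟨p', hp', heq⟩ := hp
    rw [← heq, hrG' hp']
    exact ⟨hp', rfl⟩
  refine ⟨W₁ ∩ fiberCDF κ ⁻¹' (h ⁻¹' V), fun p => r (h (fiberCDF κ p)),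
    hW₁.inter (hGm (hh hV)), hr.comp (hh.comp hGm), fun p hp => hp.1.1, ?_, ?_, ?_, ?_, ?_⟩
  · intro p hp p' hp' heq
    have := congrArg (fiberCDF κ) heq
    simp only [(hspec hp.2).2, (hspec hp'.2).2] at this
    exact hGinj hp.1 hp'.1 (hhinj this)
  · exact fun p hp => (hspec hp.2).1.1
  · intro p hp
    have := congrArg Prod.fst (hspec hp.2).2
    exact this
  · rw [compl_inter]
    exact measure_union_null hW₁null hVnull'
  · have hm : Measurable fun z => (κ z).real univ := (κ.measurable_coe .univ).ennreal_toReal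
    -- The lower half of each fibre: it contains the image and carries exactly half of the mass.
    let U : Set (Z × ℝ) := {p | p.2 ≤ (κ p.1).real univ / 2}
    have hU : MeasurableSet U :=
      measurableSet_le measurable_snd ((hm.comp measurable_fst).div_const 2)
    have hsub : (fun p => r (h (fiberCDF κ p))) '' (W₁ ∩ fiberCDF κ ⁻¹' (h ⁻¹' V)) ⊆
        fiberCDF κ ⁻¹' U := by
      rintro _ ⟨p, hp, rfl⟩
      simp only [mem_preimage, (hspec hp.2).2]
      simp only [U, h, fiberCDF, mem_ofPred_eq]
      have : (κ p.1).real (Iic p.2) ≤ (κ p.1).real univ := measureReal_mono (subset_univ _)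
      linarith
    calc 2 * (ν ⊗ₘ κ) _ ≤ 2 * (ν ⊗ₘ κ) (fiberCDF κ ⁻¹' U) := by gcongr
      _ = (ν ⊗ₘ κ) (fiberCDF κ ⁻¹' univ) := by
        rw [Measure.compProd_apply (hGm hU), Measure.compProd_apply (hGm .univ),
          ← lintegral_const_mul' _ _ (by norm_num)]
        refine lintegral_congr fun z => ?_
        rw [kernel_preimage_fiberCDF κ hU, kernel_preimage_fiberCDF κ .univ]
        have h0 : 0 ≤ (κ z).real univ := measureReal_nonneg
        have h1 : Prod.mk z ⁻¹' U ∩ Icc 0 ((κ z).real univ) = Icc 0 ((κ z).real univ / 2) := by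
          ext u
          simp only [U, preimage_ofPred_eq, mem_inter_iff, mem_ofPred_eq, mem_Icc]
          constructor
          · rintro ⟨h, h', -⟩
            exact ⟨h', h⟩
          · rintro ⟨h, h'⟩
            exact ⟨h', h, by linarith⟩
        rw [h1, preimage_univ, univ_inter, Real.volume_Icc, Real.volume_Icc,
          ← ENNReal.ofReal_ofNat, ← ENNReal.ofReal_mul (by norm_num)]
        ring_nf
      _ = _ := by rw [preimage_univ]

end Halving

/-! ### Almost everywhere countable-to-one maps in pmp graphs -/

section Pieces

open Set Filter Topology ProbabilityTheory

variable {X : Type*} [MeasurableSpace X]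

/-- The part of a kernel on `ℝ` carried by the points that are not atoms. -/
noncomputable def nonatomicPart {Z : Type*} [MeasurableSpace Z] (κ : Kernel Z ℝ)
    [IsFiniteKernel κ] : Kernel Z ℝ :=
  κ.withDensity fun z t => indicator {p : Z × ℝ | κ p.1 {p.2} = 0} 1 (z, t)

section

variable {Z : Type*} [MeasurableSpace Z] (κ : Kernel Z ℝ) [IsFiniteKernel κ]

theorem measurableSet_nonatoms : MeasurableSet {p : Z × ℝ | κ p.1 {p.2} = 0} :=
  measurable_kernel_singleton κ (measurableSet_singleton 0)

theorem nonatomicPart_apply (z : Z) (s : Set ℝ) :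
    nonatomicPart κ z s = κ z (s ∩ {t | κ z {t} = 0}) := by
  have hN := measurableSet_nonatoms κ
  have hNz : MeasurableSet {t | κ z {t} = 0} := measurable_prodMk_left (x := z) hN
  rw [nonatomicPart, Kernel.withDensity_apply' _
    (by exact measurable_one.indicator hN)]
  have : (fun t => indicator {p : Z × ℝ | κ p.1 {p.2} = 0} (1 : Z × ℝ → ENNReal) (z, t)) =
      indicator {t | κ z {t} = 0} 1 := rfl
  rw [this, lintegral_indicator_one hNz, Measure.restrict_apply hNz, inter_comm]

instance : IsFiniteKernel (nonatomicPart κ) := by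
  refine ⟨κ.bound, κ.bound_lt_top, fun z => ?_⟩
  rw [nonatomicPart_apply κ z]
  exact κ.measure_le_bound z _

instance (z : Z) : NullSingletonClass (nonatomicPart κ z) := by
  refine ⟨fun t => ?_⟩
  rw [nonatomicPart_apply κ z]
  by_cases ht : κ z {t} = 0
  · exact measure_mono_null inter_subset_left ht
  · have : {t} ∩ {t | κ z {t} = 0} = ∅ := by
      ext s
      simp only [mem_inter_iff, mem_singleton_iff, mem_ofPred_eq, mem_empty_iff_false, iff_false]
      rintro ⟨rfl, h⟩
      exact ht h
    rw [this, measure_empty]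

theorem compProd_nonatomicPart (ν : Measure Z) [SFinite ν] {S : Set (Z × ℝ)}
    (hS : MeasurableSet S) :
    (ν ⊗ₘ nonatomicPart κ) S = (ν ⊗ₘ κ) (S ∩ {p | κ p.1 {p.2} = 0}) := by
  rw [Measure.compProd_apply hS, Measure.compProd_apply (hS.inter (measurableSet_nonatoms κ))]
  refine lintegral_congr fun z => ?_
  rw [nonatomicPart_apply κ z]
  rfl

end

/-- An atom has most of the mass of some rational interval around it. -/
theorem exists_rat_Icc_measure_lt (m : Measure ℝ) [IsFiniteMeasure m] {t : ℝ} (ht : m {t} ≠ 0) :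
    ∃ p q : ℚ, t ∈ Icc (p : ℝ) q ∧ m (Icc (p : ℝ) q) < 2 * m {t} := by
  have hlt : m {t} < 2 * m {t} := by
    rw [two_mul]
    exact ENNReal.lt_add_right (measure_ne_top _ _) ht
  obtain ⟨U, htU, hU, hmU⟩ := Set.exists_isOpen_lt_of_lt {t} _ hlt
  obtain ⟨a, b, hab, habU⟩ := mem_nhds_iff_exists_Ioo_subset.1
    (hU.mem_nhds (htU (mem_singleton t)))
  obtain ⟨p, hap, hpt⟩ := exists_rat_btwn hab.1
  obtain ⟨q, htq, hqb⟩ := exists_rat_btwn hab.2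
  exact ⟨p, q, ⟨hpt.le, htq.le⟩, (measure_mono fun s hs =>
    habU ⟨hap.trans_le hs.1, hs.2.trans_lt hqb⟩).trans_lt hmU⟩

/-- In a measure-preserving graph, a Borel function that moves points within their connected
components is almost everywhere countable-to-one: it is injective on the pieces of a countable
partition of almost all of its domain. -/
theorem IsPMP.exists_injOn_pieces [StandardBorelSpace X] {G : SimpleGraph X} {μ : Measure X}
    [IsFiniteMeasure μ] (hpmp : IsPMP G μ) {Y : Set X} (hY : MeasurableSet Y) {θ : X → X}
    (hθ : Measurable θ) (hreach : ∀ x ∈ Y, G.Reachable x (θ x)) :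
    ∃ A : ℕ → Set X, (∀ n, MeasurableSet (A n)) ∧ (∀ n, A n ⊆ Y) ∧ (∀ n, InjOn θ (A n)) ∧
      Pairwise (Function.onFun Disjoint A) ∧ μ (Y \ ⋃ n, A n) = 0 := by
  rcases isEmpty_or_nonempty X with hX | hX
  · exact ⟨fun _ => ∅, by simp, by simp, by simp, fun _ _ _ => by simp [Function.onFun],
      by simp [eq_empty_of_isEmpty Y]⟩
  obtain ⟨ι, hι⟩ := exists_measurableEmbedding_real X
  -- Displays `X` as fibred over the value of `θ`, so that disintegrating the image of `μ` gives
  -- measures on the fibres of `θ`.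
  let j : X → X × ℝ := fun x => (θ x, ι x)
  have hjm : Measurable j := hθ.prodMk hι.measurable
  have hjinj : Function.Injective j := fun x y h => hι.injective (Prod.ext_iff.1 h).2
  have hj : MeasurableEmbedding j := hjm.measurableEmbedding hjinj
  let ρ := (μ.restrict Y).map j
  let κ := ρ.condKernel
  have hdis : ρ.fst ⊗ₘ κ = ρ := ρ.disintegrate κ
  let N : Set (X × ℝ) := {p | κ p.1 {p.2} = 0}
  have hN : MeasurableSet N := measurableSet_nonatoms κ
  let R := Y ∩ j ⁻¹' N
  have hR : MeasurableSet R := hY.inter (hjm hN)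
  -- `R` consists of the points that are not atoms of their fibre. The compression of
  -- `exists_halving` preserves the value of `θ`, hence the component, so pmp gives `2 * μ R ≤ μ R`.
  have hRnull : μ R = 0 := by
    have hη {S : Set (X × ℝ)} (hS : MeasurableSet S) :
        (ρ.fst ⊗ₘ nonatomicPart κ) S = μ (R ∩ j ⁻¹' S) := by
      rw [compProd_nonatomicPart κ _ hS, hdis, Measure.map_apply hjm (hS.inter hN),
        Measure.restrict_apply (hjm (hS.inter hN))]
      congr 1
      ext x
      simp only [R, N, mem_inter_iff, mem_preimage]
      tauto
    have hW : MeasurableSet (j '' R) := hj.measurableSet_image.2 hR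
    obtain ⟨A, σ, hA, hσ, hAW, hσinj, hσW, hσfst, hAnull, hhalf⟩ :=
      exists_halving ρ.fst (nonatomicPart κ) hW (by
        rw [hη hW.compl]
        have : R ∩ j ⁻¹' (j '' R)ᶜ = ∅ := by
          ext x
          simp only [mem_inter_iff, mem_preimage, mem_compl_iff, mem_empty_iff_false, iff_false]
          exact fun h => h.2 (mem_image_of_mem j h.1)
        rw [this, measure_empty])
    obtain ⟨r, hr, hrj⟩ := hj.exists_measurable_extend measurable_id (fun _ => inferInstance)
    have hrj' (x : X) : r (j x) = x := congrFun hrj x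
    have hspec {x : X} (hx : x ∈ j ⁻¹' A) :
        j (r (σ (j x))) = σ (j x) ∧ r (σ (j x)) ∈ R := by
      obtain ⟨y, hy, hy'⟩ := hσW hx
      rw [← hy', hrj']
      exact ⟨rfl, hy⟩
    have hAR : j ⁻¹' A ⊆ R := fun x hx => by
      obtain ⟨y, hy, hyx⟩ := hAW hx
      exact hjinj hyx ▸ hy
    have hpres := hpmp (j ⁻¹' A) (fun x => r (σ (j x))) (hjm hA)
      ((hr.comp (hσ.comp hjm)).comp measurable_subtype_coe)
      (fun x hx y hy h => by
        have := congrArg j h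
        simp only [(hspec hx).1, (hspec hy).1] at this
        exact hjinj (hσinj hx hy this))
      (fun x hx => by
        have h1 := hreach x (hAR hx).1
        have h2 := hreach _ (hspec hx).2.1
        have h3 : θ (r (σ (j x))) = θ x := by
          have := congrArg Prod.fst (hspec hx).1
          rw [hσfst _ hx] at this
          exact this
        rw [h3] at h2
        exact h1.trans h2.symm) (j ⁻¹' A) Subset.rfl (hjm hA)
    have hfull : μ (j ⁻¹' A) = μ R := by
      rw [hη hA.compl] at hAnull
      rw [← measure_inter_add_sdiff R (hjm hA)]
      have : R \ j ⁻¹' A = R ∩ j ⁻¹' Aᶜ := rfl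
      rw [this, hAnull, add_zero, inter_eq_right.2 hAR]
    rw [hη (hA.image_of_measurable_injOn hσ hσinj), hη .univ, preimage_univ, inter_univ] at hhalf
    have hle : μ ((fun x => r (σ (j x))) '' (j ⁻¹' A)) ≤ μ (R ∩ j ⁻¹' (σ '' A)) := by
      refine measure_mono ?_
      rintro _ ⟨x, hx, rfl⟩
      exact ⟨(hspec hx).2, j x, hx, (hspec hx).1.symm⟩
    rw [hpres, hfull] at hle
    have h2 : 2 * μ R ≤ μ R := le_trans (by gcongr) hhalf
    by_contra hne
    rw [two_mul] at h2
    exact absurd h2 (not_le.2 (ENNReal.lt_add_right (measure_ne_top _ _) hne))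
  -- Points carrying more than half of the fibre mass of a fixed rational interval around them. A
  -- fibre has at most one such point, so `θ` is injective here.
  let S : ℚ × ℚ → Set X := fun pq => Y ∩ {x | ι x ∈ Icc (pq.1 : ℝ) pq.2 ∧
    κ (θ x) (Icc (pq.1 : ℝ) pq.2) < 2 * κ (θ x) {ι x}}
  have hS (pq) : MeasurableSet (S pq) :=
    hY.inter ((hι.measurable measurableSet_Icc).inter
      (measurableSet_lt ((κ.measurable_coe measurableSet_Icc).comp hθ)
        (((measurable_kernel_singleton κ).comp hjm).const_mul 2)))
  have hSinj (pq) : InjOn θ (S pq) := by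
    rintro x ⟨-, hx, hx'⟩ y ⟨-, hy, hy'⟩ hxy
    by_contra hne
    rw [hxy] at hx'
    have h1 : κ (θ y) {ι x} + κ (θ y) {ι y} ≤ κ (θ y) (Icc (pq.1 : ℝ) pq.2) := by
      rw [← measure_union (by simpa using hι.injective.ne hne) (measurableSet_singleton _)]
      refine measure_mono ?_
      rintro _ (rfl | rfl)
      exacts [hx, hy]
    have h2 := ENNReal.add_lt_add hx' hy'
    rw [← mul_add, ← two_mul] at h2
    exact absurd h2 (not_lt.2 (by gcongr))
  let e := (Denumerable.eqv (ℚ × ℚ)).symm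
  refine ⟨disjointed (S ∘ e), fun n => MeasurableSet.disjointed (fun i => hS _) n,
    fun n => (disjointed_subset _ n).trans inter_subset_left,
    fun n => (hSinj (e n)).mono (disjointed_subset _ n), disjoint_disjointed _, ?_⟩
  rw [iUnion_disjointed]
  refine measure_mono_null (t := R) (fun x hx => ⟨hx.1, ?_⟩) hRnull
  by_contra hne
  obtain ⟨p, q, hpq, hlt⟩ := exists_rat_Icc_measure_lt (κ (θ x)) (t := ι x) hne
  refine hx.2 (mem_iUnion.2 ⟨e.symm (p, q), ?_⟩)
  simp only [Function.comp, Equiv.apply_symm_apply]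
  exact ⟨hx.1, hpq, hlt⟩

end Pieces

/-! ### The edge measure and mass transport -/

section EdgeMeasure

open Set

variable {X : Type*} [MeasurableSpace X]

/-- A Borel enumeration of the neighbors of the vertices in a set `V`, by `d` partial functions. -/
structure Enumeration (G : SimpleGraph X) (V : Set X) (d : ℕ) where
  /-- The domains. -/
  dom : Fin d → Set X
  /-- The functions. -/
  nbr : Fin d → X → X
  measurableSet_dom : ∀ i, MeasurableSet (dom i)
  measurable_nbr : ∀ i, Measurable (nbr i)
  dom_subset : ∀ i, dom i ⊆ V
  adj_iff : ∀ x ∈ V, ∀ y, G.Adj x y ↔ ∃ i, x ∈ dom i ∧ nbr i x = y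
  index_eq : ∀ x i j, x ∈ dom i → x ∈ dom j → nbr i x = nbr j x → i = j

theorem exists_enumeration [StandardBorelSpace X] {G : SimpleGraph X} {μ : Measure X} [NeZero μ]
    (hG : IsBorel G) (hdeg : HasBoundedDegree G μ) :
    ∃ (V : Set X) (d : ℕ), MeasurableSet V ∧ μ Vᶜ = 0 ∧ Nonempty (Enumeration G V d) := by
  obtain ⟨d, hd⟩ := hdeg
  let V := (toMeasurable μ {x | ¬ (G.neighborSet x).encard ≤ d})ᶜ
  have hV : MeasurableSet V := (measurableSet_toMeasurable _ _).compl
  have hVnull : μ Vᶜ = 0 := by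
    rw [compl_compl, measure_toMeasurable]
    exact hd
  have hVdeg {x : X} (hx : x ∈ V) : (G.neighborSet x).encard ≤ d := by
    by_contra h
    exact hx (subset_toMeasurable _ _ h)
  have : Nonempty X := μ.nonempty_of_neZero
  obtain ⟨A, θ, hA, hθ, henum, hdist⟩ := exists_enumeration_of_encard_le d
    ({p : X × X | G.Adj p.1 p.2} ∩ Prod.fst ⁻¹' V) (hG.inter (measurable_fst hV)) (fun x => by
      by_cases hx : x ∈ V
      · refine le_trans (encard_le_encard fun y hy => ?_) (hVdeg hx)
        exact hy.1
      · simp [hx])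
  refine ⟨V, d, hV, hVnull, ⟨⟨A, θ, hA, hθ, fun i x hx => ?_, fun x hx y => ?_, hdist⟩⟩⟩
  · exact ((henum x (θ i x)).2 ⟨i, hx, rfl⟩).2
  · rw [← henum x y]
    simp [hx]

namespace Enumeration

variable {G : SimpleGraph X} {V : Set X} {d : ℕ} (D : Enumeration G V d) {μ : Measure X}

theorem adj {i : Fin d} {x : X} (hx : x ∈ D.dom i) : G.Adj x (D.nbr i x) :=
  (D.adj_iff x (D.dom_subset i hx) _).2 ⟨i, hx, rfl⟩

theorem measurable_edge (i : Fin d) : Measurable fun x => (x, D.nbr i x) :=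
  measurable_id.prodMk (D.measurable_nbr i)

/-- The measure on the set of (oriented) edges. -/
noncomputable def edgeMeasure (μ : Measure X) : Measure (X × X) :=
  ∑ i, (μ.restrict (D.dom i)).map fun x => (x, D.nbr i x)

theorem edgeMeasure_apply {S : Set (X × X)} (hS : MeasurableSet S) :
    D.edgeMeasure μ S = ∑ i, μ ((fun x => (x, D.nbr i x)) ⁻¹' S ∩ D.dom i) := by
  rw [edgeMeasure, Measure.finsetSum_apply]
  refine Finset.sum_congr rfl fun i _ => ?_
  rw [Measure.map_apply (D.measurable_edge i) hS,
    Measure.restrict_apply (D.measurable_edge i hS)]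

/-- The edges split into countably many pieces on which the second endpoint determines the first. By
pmp the mass of a piece equals the measure of its set of second endpoints, almost all of which lie
in `V` and thus see the reversed edges in their own enumeration. Applied to the swapped set, this
also gives the opposite inequality. -/
theorem edgeMeasure_le_swap [StandardBorelSpace X] [IsFiniteMeasure μ] (hpmp : IsPMP G μ)
    (hV : μ Vᶜ = 0) {S : Set (X × X)} (hS : MeasurableSet S) :
    D.edgeMeasure μ S ≤ D.edgeMeasure μ (Prod.swap ⁻¹' S) := by
  choose B hB hBsub hBinj hBdisj hBnull using fun i =>
    hpmp.exists_injOn_pieces (D.measurableSet_dom i) (D.measurable_nbr i)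
      (fun x hx => (D.adj hx).reachable)
  let C : Fin d × ℕ → Set X := fun p => B p.1 p.2 ∩ (fun x => (x, D.nbr p.1 x)) ⁻¹' S
  have hC (p) : MeasurableSet (C p) := (hB p.1 p.2).inter (D.measurable_edge p.1 hS)
  let Γ : Fin d × ℕ → Set (X × X) := fun p => (fun x => (D.nbr p.1 x, x)) '' C p
  have hΓ (p) : MeasurableSet (Γ p) :=
    (hC p).image_of_measurable_injOn ((D.measurable_nbr p.1).prodMk measurable_id)
      (fun x _ y _ h => (Prod.ext_iff.1 h).2)
  have hΓdisj : Pairwise (Function.onFun Disjoint Γ) := by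
    intro p q hpq
    refine disjoint_left.2 ?_
    rintro _ ⟨x, hx, rfl⟩ ⟨y, hy, hxy⟩
    obtain ⟨h1, rfl⟩ := Prod.ext_iff.1 hxy
    have hi : q.1 = p.1 := D.index_eq y _ _ (hBsub _ _ hy.1) (hBsub _ _ hx.1) h1
    have hn : p.2 ≠ q.2 := fun h => hpq (Prod.ext hi.symm h)
    exact disjoint_left.1 (hBdisj p.1 hn) hx.1 (hi ▸ hy.1)
  have hpiece (p) : μ (C p) ≤ D.edgeMeasure μ (Γ p) := by
    have hpres := hpmp (B p.1 p.2) (D.nbr p.1) (hB p.1 p.2)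
      ((D.measurable_nbr p.1).comp measurable_subtype_coe) (hBinj p.1 p.2)
      (fun x hx => (D.adj (hBsub p.1 p.2 hx)).reachable) (C p) inter_subset_left (hC p)
    rw [← hpres, D.edgeMeasure_apply (hΓ p)]
    calc μ (D.nbr p.1 '' C p)
        ≤ μ (Vᶜ ∪ ⋃ j, (fun x => (x, D.nbr j x)) ⁻¹' (Γ p) ∩ D.dom j) := by
          refine measure_mono ?_
          rintro _ ⟨x, hx, rfl⟩
          by_cases hy : D.nbr p.1 x ∈ V
          · obtain ⟨j, hj, hjx⟩ := (D.adj_iff _ hy x).1 (D.adj (hBsub p.1 p.2 hx.1)).symm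
            refine Or.inr (mem_iUnion.2 ⟨j, ?_, hj⟩)
            simp only [mem_preimage, hjx]
            exact mem_image_of_mem _ hx
          · exact Or.inl hy
      _ ≤ μ Vᶜ + μ (⋃ j, (fun x => (x, D.nbr j x)) ⁻¹' (Γ p) ∩ D.dom j) := measure_union_le _ _
      _ ≤ _ := by
          rw [hV, zero_add]
          exact measure_iUnion_fintype_le _ _
  calc D.edgeMeasure μ S
      = ∑ i, μ ((fun x => (x, D.nbr i x)) ⁻¹' S ∩ D.dom i) := D.edgeMeasure_apply hS
    _ ≤ ∑ i, ∑' n, μ (C (i, n)) := by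
        refine Finset.sum_le_sum fun i _ => ?_
        calc μ ((fun x => (x, D.nbr i x)) ⁻¹' S ∩ D.dom i)
            ≤ μ ((D.dom i \ ⋃ n, B i n) ∪ ⋃ n, C (i, n)) := by
              refine measure_mono fun x hx => ?_
              by_cases hxB : x ∈ ⋃ n, B i n
              · obtain ⟨n, hn⟩ := mem_iUnion.1 hxB
                exact Or.inr (mem_iUnion.2 ⟨n, hn, hx.1⟩)
              · exact Or.inl ⟨hx.2, hxB⟩
          _ ≤ μ (D.dom i \ ⋃ n, B i n) + μ (⋃ n, C (i, n)) := measure_union_le _ _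
          _ ≤ _ := by
              rw [hBnull, zero_add]
              exact measure_iUnion_le _
    _ = ∑' p, μ (C p) := by
        rw [← tsum_fintype (L := .unconditional _)]
        exact (ENNReal.tsum_prod (f := fun i n => μ (C (i, n)))).symm
    _ ≤ ∑' p, D.edgeMeasure μ (Γ p) := ENNReal.tsum_le_tsum hpiece
    _ = D.edgeMeasure μ (⋃ p, Γ p) := (measure_iUnion hΓdisj hΓ).symm
    _ ≤ _ := by
        refine measure_mono (iUnion_subset fun p => ?_)
        rintro _ ⟨x, hx, rfl⟩
        exact hx.2

/-- The mass transport principle. -/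
theorem map_swap_edgeMeasure [StandardBorelSpace X] [IsFiniteMeasure μ] (hpmp : IsPMP G μ)
    (hV : μ Vᶜ = 0) : (D.edgeMeasure μ).map Prod.swap = D.edgeMeasure μ := by
  ext S hS
  rw [Measure.map_apply measurable_swap hS]
  refine le_antisymm ?_ (D.edgeMeasure_le_swap hpmp hV hS)
  exact D.edgeMeasure_le_swap hpmp hV (measurable_swap hS)

theorem map_fst_edgeMeasure_le : (D.edgeMeasure μ).map Prod.fst ≤ (d : ENNReal) • μ := by
  refine Measure.le_iff.2 fun s hs => ?_
  rw [Measure.map_apply measurable_fst hs, D.edgeMeasure_apply (measurable_fst hs)]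
  calc ∑ i, μ ((fun x => (x, D.nbr i x)) ⁻¹' (Prod.fst ⁻¹' s) ∩ D.dom i)
      ≤ ∑ _i : Fin d, μ s := Finset.sum_le_sum fun i _ => measure_mono fun x hx => hx.1
    _ = _ := by simp

theorem map_snd_edgeMeasure_le [StandardBorelSpace X] [IsFiniteMeasure μ] (hpmp : IsPMP G μ)
    (hV : μ Vᶜ = 0) : (D.edgeMeasure μ).map Prod.snd ≤ (d : ENNReal) • μ := by
  rw [← D.map_swap_edgeMeasure hpmp hV, Measure.map_map measurable_snd measurable_swap]
  exact D.map_fst_edgeMeasure_le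

/-- Points whose `i`-th neighbor lies in `s` inject into the edges ending in `s`; reversed, these
are edges starting in `s`, at most `d` from each vertex. -/
theorem map_nbr_le [StandardBorelSpace X] [IsFiniteMeasure μ] (hpmp : IsPMP G μ)
    (hV : μ Vᶜ = 0) (i : Fin d) :
    (μ.restrict (D.dom i)).map (D.nbr i) ≤ (d : ENNReal) • μ := by
  refine le_trans (Measure.le_iff.2 fun s hs => ?_) (D.map_snd_edgeMeasure_le hpmp hV)
  rw [Measure.map_apply measurable_snd hs, D.edgeMeasure_apply (measurable_snd hs),
    Measure.map_apply (D.measurable_nbr i) hs, Measure.restrict_apply (D.measurable_nbr i hs)]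
  exact Finset.single_le_sum (f := fun i => μ ((fun x => (x, D.nbr i x)) ⁻¹'
    (Prod.snd ⁻¹' s) ∩ D.dom i)) (fun _ _ => zero_le) (Finset.mem_univ i)

theorem integral_edgeMeasure {h : X × X → ℂ} (hh : Integrable h (D.edgeMeasure μ)) :
    ∫ p, h p ∂D.edgeMeasure μ = ∑ i, ∫ x in D.dom i, h (x, D.nbr i x) ∂μ := by
  have hle (i : Fin d) :
      (μ.restrict (D.dom i)).map (fun x => (x, D.nbr i x)) ≤ D.edgeMeasure μ :=
    Measure.le_iff.2 fun s _ => by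
      rw [edgeMeasure, Measure.finsetSum_apply]
      exact Finset.single_le_sum
        (f := fun i => (μ.restrict (D.dom i)).map (fun x => (x, D.nbr i x)) s)
        (fun _ _ => zero_le) (Finset.mem_univ i)
  have hint (i : Fin d) : Integrable h ((μ.restrict (D.dom i)).map fun x => (x, D.nbr i x)) :=
    hh.mono_measure (hle i)
  rw [edgeMeasure, integral_finsetSum_measure fun i _ => hint i]
  refine Finset.sum_congr rfl fun i _ => ?_
  rw [integral_map (D.measurable_edge i).aemeasurable (hint i).aestronglyMeasurable]

end Enumeration

end EdgeMeasure

/-! ### The adjacency operator on L² -/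

section Operator

open Set

variable {X : Type*} [MeasurableSpace X]

section WeightedComp

variable {μ : Measure X} {A : Set X} {θ : X → X} {c : ENNReal}

theorem eLpNorm_indicator_comp_le (hA : MeasurableSet A) (hθ : Measurable θ)
    (h : (μ.restrict A).map θ ≤ c • μ) {f : X → ℂ} (hf : StronglyMeasurable f) :
    eLpNorm (A.indicator (f ∘ θ)) 2 μ ≤ c ^ (1 / 2 : ℝ) * eLpNorm f 2 μ := by
  rw [eLpNorm_indicator_eq_eLpNorm_restrict hA,
    ← eLpNorm_map_measure hf.aestronglyMeasurable hθ.aemeasurable]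
  refine (eLpNorm_mono_measure f h).trans ?_
  rw [eLpNorm_smul_measure_of_ne_top (by simp)]
  simp

theorem memLp_indicator_comp (hA : MeasurableSet A) (hθ : Measurable θ) (hc : c ≠ ⊤)
    (h : (μ.restrict A).map θ ≤ c • μ) (f : Lp ℂ 2 μ) :
    MemLp (A.indicator (f ∘ θ)) 2 μ :=
  ⟨(((Lp.stronglyMeasurable f).comp_measurable hθ).indicator hA).aestronglyMeasurable,
    (eLpNorm_indicator_comp_le hA hθ h (Lp.stronglyMeasurable f)).trans_lt
      (ENNReal.mul_lt_top (ENNReal.rpow_lt_top_of_nonneg (by norm_num) hc)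
        (Lp.eLpNorm_lt_top f))⟩

/-- Makes composition with `θ` well defined on almost-everywhere classes: the bound on the image
measure gives absolute continuity. -/
theorem ae_indicator_comp_congr (hA : MeasurableSet A) (hθ : Measurable θ)
    (h : (μ.restrict A).map θ ≤ c • μ) {f g : X → ℂ} (hfg : f =ᵐ[μ] g) :
    A.indicator (f ∘ θ) =ᵐ[μ] A.indicator (g ∘ θ) := by
  have h1 : f =ᵐ[(μ.restrict A).map θ] g :=
    (Measure.absolutelyContinuous_of_le_smul h).ae_eq hfg
  have h2 := ae_of_ae_map hθ.aemeasurable h1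
  rw [ae_restrict_iff' hA] at h2
  filter_upwards [h2] with x hx
  by_cases hxA : x ∈ A
  · simpa [hxA] using hx hxA
  · simp [hxA]

/-- The bounded operator `f ↦ 1_A · (f ∘ θ)` on `L²(μ)`, where `θ` does not concentrate the measure
of `A` by more than a constant factor. -/
noncomputable def weightedComp (hA : MeasurableSet A) (hθ : Measurable θ) (hc : c ≠ ⊤)
    (h : (μ.restrict A).map θ ≤ c • μ) : Lp ℂ 2 μ →L[ℂ] Lp ℂ 2 μ :=
  LinearMap.mkContinuous
    { toFun := fun f => (memLp_indicator_comp hA hθ hc h f).toLp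
      map_add' := fun f g => by
        rw [← MemLp.toLp_add, MemLp.toLp_eq_toLp_iff]
        refine (ae_indicator_comp_congr hA hθ h (Lp.coeFn_add f g)).trans ?_
        rw [Pi.add_comp, indicator_add']
      map_smul' := fun a f => by
        rw [RingHom.id_apply, ← MemLp.toLp_const_smul, MemLp.toLp_eq_toLp_iff]
        refine (ae_indicator_comp_congr hA hθ h (Lp.coeFn_smul a f)).trans ?_
        rw [Pi.smul_comp]
        exact (indicator_const_smul A a (f ∘ θ)).eventuallyEq }
    (c ^ (1 / 2 : ℝ)).toReal fun f => by
      change ‖(memLp_indicator_comp hA hθ hc h f).toLp‖ ≤ _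
      rw [Lp.norm_toLp, Lp.norm_def, ← ENNReal.toReal_mul]
      exact ENNReal.toReal_mono
        (ENNReal.mul_ne_top (ENNReal.rpow_ne_top_of_nonneg (by norm_num) hc)
          (Lp.eLpNorm_ne_top f))
        (eLpNorm_indicator_comp_le hA hθ h (Lp.stronglyMeasurable f))

theorem weightedComp_ae (hA : MeasurableSet A) (hθ : Measurable θ) (hc : c ≠ ⊤)
    (h : (μ.restrict A).map θ ≤ c • μ) (f : Lp ℂ 2 μ) :
    weightedComp hA hθ hc h f =ᵐ[μ] A.indicator (f ∘ θ) :=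
  MemLp.coeFn_toLp (memLp_indicator_comp hA hθ hc h f)

end WeightedComp

namespace Enumeration

variable {G : SimpleGraph X} {V : Set X} {d : ℕ} (D : Enumeration G V d) {μ : Measure X}

theorem finsum_neighborSet {x : X} (hx : x ∈ V) (f : X → ℂ) :
    ∑ᶠ y ∈ G.neighborSet x, f y = ∑ i, (D.dom i).indicator (f ∘ D.nbr i) x := by
  classical
  have hset : G.neighborSet x =
      ((Finset.univ.filter fun i => x ∈ D.dom i).image fun i => D.nbr i x : Finset X) := by
    ext y
    simp [D.adj_iff x hx y]
  rw [hset, finsum_mem_coe_finset, Finset.sum_image, Finset.sum_filter]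
  · rfl
  · intro i hi j hj hij
    simp only [Finset.coe_filter, Finset.mem_univ, true_and, mem_ofPred_eq] at hi hj
    exact D.index_eq x i j hi hj hij

theorem memLp_fst (f : Lp ℂ 2 μ) : MemLp (fun p : X × X => f p.1) 2 (D.edgeMeasure μ) := by
  have h : MemLp f 2 ((D.edgeMeasure μ).map Prod.fst) :=
    (Lp.memLp f).of_measure_le_smul (ENNReal.natCast_ne_top d) D.map_fst_edgeMeasure_le
  exact h.comp_of_map measurable_fst.aemeasurable

variable [StandardBorelSpace X] [IsFiniteMeasure μ]

/-- The adjacency operator as a sum of composition operators. -/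
noncomputable def operator (hpmp : IsPMP G μ) (hV : μ Vᶜ = 0) : Lp ℂ 2 μ →L[ℂ] Lp ℂ 2 μ :=
  ∑ i, weightedComp (D.measurableSet_dom i) (D.measurable_nbr i) (ENNReal.natCast_ne_top d)
    (D.map_nbr_le hpmp hV i)

theorem operator_ae (hpmp : IsPMP G μ) (hV : μ Vᶜ = 0) (f : Lp ℂ 2 μ) :
    D.operator hpmp hV f =ᵐ[μ] fun x => ∑ i, (D.dom i).indicator (f ∘ D.nbr i) x := by
  have h1 : ∀ᵐ x ∂μ, ∀ i, weightedComp (D.measurableSet_dom i) (D.measurable_nbr i)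
      (ENNReal.natCast_ne_top d) (D.map_nbr_le hpmp hV i) f x =
        (D.dom i).indicator (f ∘ D.nbr i) x :=
    ae_all_iff.2 fun i => weightedComp_ae _ _ _ _ f
  have h2 := Lp.coeFn_finsetSum (Finset.univ : Finset (Fin d)) fun i =>
    weightedComp (D.measurableSet_dom i) (D.measurable_nbr i) (ENNReal.natCast_ne_top d)
      (D.map_nbr_le hpmp hV i) f
  rw [operator, _root_.sum_apply]
  filter_upwards [h1, h2] with x hx1 hx2
  rw [hx2, Finset.sum_apply]
  exact Finset.sum_congr rfl fun i _ => hx1 i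

theorem isAdjacencyOperator (hpmp : IsPMP G μ) (hV : μ Vᶜ = 0) :
    IsAdjacencyOperator G μ (D.operator hpmp hV) := by
  intro f
  have hV' : ∀ᵐ x ∂μ, x ∈ V := hV
  filter_upwards [D.operator_ae hpmp hV f, hV'] with x hx hxV
  rw [hx, D.finsum_neighborSet hxV]

theorem memLp_snd (hpmp : IsPMP G μ) (hV : μ Vᶜ = 0) (f : Lp ℂ 2 μ) :
    MemLp (fun p : X × X => f p.2) 2 (D.edgeMeasure μ) := by
  have h : MemLp f 2 ((D.edgeMeasure μ).map Prod.snd) :=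
    (Lp.memLp f).of_measure_le_smul (ENNReal.natCast_ne_top d) (D.map_snd_edgeMeasure_le hpmp hV)
  exact h.comp_of_map measurable_snd.aemeasurable

/-- Writing the form as one integral over oriented edges, with `f` and `g` at opposite ends, reduces
self-adjointness to invariance of the edge measure under reversal. -/
theorem inner_operator_left (hpmp : IsPMP G μ) (hV : μ Vᶜ = 0) (f g : Lp ℂ 2 μ) :
    inner ℂ (D.operator hpmp hV f) g =
      ∫ p, inner ℂ (f p.2) (g p.1) ∂D.edgeMeasure μ := by
  have hint : Integrable (fun p : X × X => inner ℂ (f p.2) (g p.1)) (D.edgeMeasure μ) := by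
    simp only [RCLike.inner_apply]
    exact (D.memLp_fst g).integrable_mul (D.memLp_snd hpmp hV f).star
  rw [D.integral_edgeMeasure hint, operator, _root_.sum_apply, sum_inner]
  refine Finset.sum_congr rfl fun i _ => ?_
  rw [L2.inner_def, ← integral_indicator (D.measurableSet_dom i)]
  refine integral_congr_ae ?_
  filter_upwards [weightedComp_ae (D.measurableSet_dom i) (D.measurable_nbr i)
    (ENNReal.natCast_ne_top d) (D.map_nbr_le hpmp hV i) f] with x hx
  rw [hx]
  by_cases hxi : x ∈ D.dom i <;> simp [hxi]

theorem isSelfAdjoint_operator (hpmp : IsPMP G μ) (hV : μ Vᶜ = 0) :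
    IsSelfAdjoint (D.operator hpmp hV) := by
  rw [ContinuousLinearMap.isSelfAdjoint_iff_isSymmetric]
  intro f g
  simp only [ContinuousLinearMap.coe_coe]
  rw [← inner_conj_symm f, D.inner_operator_left, D.inner_operator_left,
    ← integral_conj]
  simp only [inner_conj_symm]
  nth_rewrite 1 [← D.map_swap_edgeMeasure hpmp hV]
  exact integral_map_equiv MeasurableEquiv.prodComm _

end Enumeration

end Operator

/-! ### Borel colorings and edge density -/

section Coloring

open Set Filter Topology

variable {X : Type*} [MeasurableSpace X]

theorem sInf_eq_iff_of_nonempty {S : Set ℕ} (hS : S.Nonempty) {n : ℕ} :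
    sInf S = n ↔ n ∈ S ∧ ∀ m < n, m ∉ S := by
  constructor
  · rintro rfl
    exact ⟨Nat.sInf_mem hS, fun m => Nat.notMem_of_lt_sInf⟩
  · rintro ⟨h1, h2⟩
    exact le_antisymm (Nat.sInf_le h1) (not_lt.1 fun h => h2 _ h (Nat.sInf_mem hS))

namespace Enumeration

variable {G : SimpleGraph X} {V : Set X} {d : ℕ} (D : Enumeration G V d)

/-- A locally finite Borel graph has a countable Borel coloring. -/
theorem exists_nat_coloring [StandardBorelSpace X] :
    ∃ c : X → ℕ, Measurable c ∧ ∀ i, ∀ x ∈ D.dom i, c x ≠ c (D.nbr i x) := by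
  classical
  obtain ⟨ι, hι⟩ := exists_measurableEmbedding_real X
  let e := (Denumerable.eqv (ℚ × ℚ)).symm
  let U : ℕ → Set X := fun n => ι ⁻¹' Ioo ((e n).1 : ℝ) (e n).2
  have hU (n) : MeasurableSet (U n) := hι.measurable measurableSet_Ioo
  -- A vertex has finitely many enumerated neighbors, so some rational interval isolates it from
  -- them. The color is the index of the first such interval.
  have hex (x : X) : ∃ n, x ∈ U n ∧ ∀ i, x ∈ D.dom i → D.nbr i x ∉ U n := by
    let F : Finset ℝ := (Finset.univ.filter fun i => x ∈ D.dom i).image fun i => ι (D.nbr i x)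
    have hF : ι x ∈ (F : Set ℝ)ᶜ := by
      simp only [F, mem_compl_iff, Finset.mem_coe, Finset.mem_image, Finset.mem_filter,
        Finset.mem_univ, true_and, not_exists, not_and]
      exact fun i hi h => (D.adj hi).ne (hι.injective h).symm
    obtain ⟨a, b, hab, habF⟩ := mem_nhds_iff_exists_Ioo_subset.1
      (F.finite_toSet.isClosed.isOpen_compl.mem_nhds hF)
    obtain ⟨p, hap, hpt⟩ := exists_rat_btwn hab.1
    obtain ⟨q, htq, hqb⟩ := exists_rat_btwn hab.2
    refine ⟨e.symm (p, q), ?_, fun i hi h => ?_⟩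
    · simp only [U, Equiv.apply_symm_apply]
      exact ⟨hpt, htq⟩
    · simp only [U, Equiv.apply_symm_apply] at h
      refine habF ⟨hap.trans h.1, h.2.trans hqb⟩ ?_
      simp only [F, Finset.mem_coe, Finset.mem_image, Finset.mem_filter, Finset.mem_univ, true_and]
      exact ⟨i, hi, rfl⟩
  refine ⟨fun x => Nat.find (hex x), measurable_find hex fun n => ?_, fun i x hx h => ?_⟩
  · have : {x | x ∈ U n ∧ ∀ i, x ∈ D.dom i → D.nbr i x ∉ U n} =
        U n ∩ ⋂ i, (D.dom i ∩ D.nbr i ⁻¹' U n)ᶜ := by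
      ext x
      simp
    rw [this]
    exact (hU n).inter (MeasurableSet.iInter fun i =>
      ((D.measurableSet_dom i).inter (D.measurable_nbr i (hU n))).compl)
  · have h1 := (Nat.find_spec (hex x)).2 i hx
    have h2 := (Nat.find_spec (hex (D.nbr i x))).1
    beta_reduce at h
    rw [← h] at h2
    exact h1 h2

/-- Greedy coloring along a Borel ranking of the vertices. -/
theorem exists_greedy_coloring {A : Set X} (hA : MeasurableSet A) (hAV : A ⊆ V) {W : Type*}
    [LinearOrder W] [WellFoundedLT W] [Countable W] (r : X → W)
    (hr : ∀ w, MeasurableSet (r ⁻¹' {w})) (k : ℕ)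
    (hne : ∀ x ∈ A, ∀ i, x ∈ D.dom i → D.nbr i x ∈ A → r x ≠ r (D.nbr i x))
    (hk : ∀ x ∈ A, {i | x ∈ D.dom i ∧ D.nbr i x ∈ A ∧ r (D.nbr i x) < r x}.ncard ≤ k) :
    ∃ c : X → ℕ, (∀ x ∈ A, c x ≤ k) ∧ (∀ x ∈ A, ∀ y ∈ A, G.Adj x y → c x ≠ c y) ∧
      ∀ n, MeasurableSet {x | x ∈ A ∧ c x = n} := by
  classical
  have hwf : WellFounded fun x y : X => r x < r y := InvImage.wf r wellFounded_lt
  obtain ⟨c, hc⟩ : ∃ c : X → ℕ, ∀ x, c x = sInf {n | ∀ i, x ∈ D.dom i → D.nbr i x ∈ A →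
      r (D.nbr i x) < r x → c (D.nbr i x) ≠ n} :=
    ⟨hwf.fix fun x ih => sInf {n | ∀ i, x ∈ D.dom i → D.nbr i x ∈ A →
      ∀ h : r (D.nbr i x) < r x, ih (D.nbr i x) h ≠ n}, fun x => hwf.fix_eq _ x⟩
  let S : X → Set ℕ := fun x => {n | ∀ i, x ∈ D.dom i → D.nbr i x ∈ A →
      r (D.nbr i x) < r x → c (D.nbr i x) ≠ n}
  have hcS (x : X) : c x = sInf (S x) := hc x
  -- At most `k` of the `k + 1` colors `0, …, k` are taken by neighbors of smaller rank.
  have hfree {x : X} (hx : x ∈ A) : ∃ n ≤ k, n ∈ S x := by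
    let I := {i | x ∈ D.dom i ∧ D.nbr i x ∈ A ∧ r (D.nbr i x) < r x}
    have hcard : ((fun i => c (D.nbr i x)) '' I).ncard < (Iic k : Set ℕ).ncard := by
      calc _ ≤ I.ncard := ncard_image_le I.toFinite
        _ ≤ k := hk x hx
        _ < _ := by
          rw [← Nat.card_coe_set_eq]
          simp
    obtain ⟨n, hn, hn'⟩ := exists_mem_notMem_of_ncard_lt_ncard hcard
    exact ⟨n, hn, fun i h1 h2 h3 h4 => hn' ⟨i, ⟨h1, h2, h3⟩, h4⟩⟩
  have hSne {x : X} (hx : x ∈ A) : (S x).Nonempty := by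
    obtain ⟨n, -, hn⟩ := hfree hx
    exact ⟨n, hn⟩
  have hlt {x y : X} (hx : x ∈ A) (hy : y ∈ A) (hxy : G.Adj x y) (h : r y < r x) : c x ≠ c y := by
    obtain ⟨i, hi, rfl⟩ := (D.adj_iff x (hAV hx) y).1 hxy
    have : c x ∈ S x := hcS x ▸ Nat.sInf_mem (hSne hx)
    exact (this i hi hy h).symm
  refine ⟨c, fun x hx => ?_, fun x hx y hy hxy => ?_, fun n => ?_⟩
  · obtain ⟨n, hn, hnS⟩ := hfree hx
    exact hcS x ▸ (Nat.sInf_le hnS).trans hn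
  · obtain ⟨i, hi, rfl⟩ := (D.adj_iff x (hAV hx) y).1 hxy
    rcases lt_or_gt_of_ne (hne x hx i hi hy) with h | h
    · exact (hlt hy hx hxy.symm h).symm
    · exact hlt hx hy hxy h
  · have key (w : W) : ∀ n, MeasurableSet {x | x ∈ A ∧ r x = w ∧ c x = n} := by
      induction w using WellFoundedLT.induction with
      | ind w ih =>
        intro n
        let Bad : ℕ → Set X := fun m => ⋃ i, D.dom i ∩ ⋃ w' : Iio w,
          D.nbr i ⁻¹' {y | y ∈ A ∧ r y = w' ∧ c y = m}
        have hBad (m) : MeasurableSet (Bad m) := MeasurableSet.iUnion fun i =>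
          (D.measurableSet_dom i).inter (MeasurableSet.iUnion fun w' =>
            D.measurable_nbr i (ih w' w'.2 m))
        have hBadS {x : X} (hx : r x = w) (m : ℕ) : x ∈ Bad m ↔ m ∉ S x := by
          simp only [Bad, S, mem_iUnion, mem_inter_iff, mem_preimage, mem_ofPred_eq, not_forall,
            not_not, hx]
          constructor
          · rintro ⟨i, hi, w', h1, h2, h3⟩
            exact ⟨i, hi, h1, h2 ▸ w'.2, h3⟩
          · rintro ⟨i, hi, h1, h2, h3⟩
            exact ⟨i, hi, ⟨_, h2⟩, h1, rfl, h3⟩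
        have : {x | x ∈ A ∧ r x = w ∧ c x = n} =
            (A ∩ r ⁻¹' {w}) ∩ ((Bad n)ᶜ ∩ ⋂ m : Iio n, Bad m) := by
          ext x
          simp only [mem_ofPred_eq, mem_inter_iff, mem_preimage, mem_singleton_iff, mem_compl_iff,
            mem_iInter]
          constructor
          · rintro ⟨hx, hw, hcn⟩
            rw [hcS, sInf_eq_iff_of_nonempty (hSne hx)] at hcn
            exact ⟨⟨hx, hw⟩, by simpa [hBadS hw] using hcn.1,
              fun m => (hBadS hw m).2 (hcn.2 m m.2)⟩
          · rintro ⟨⟨hx, hw⟩, h1, h2⟩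
            refine ⟨hx, hw, ?_⟩
            rw [hcS, sInf_eq_iff_of_nonempty (hSne hx)]
            exact ⟨by simpa [hBadS hw] using h1, fun m hm => (hBadS hw m).1 (h2 ⟨m, hm⟩)⟩
        rw [this]
        exact (hA.inter (hr w)).inter ((hBad n).compl.inter (MeasurableSet.iInter fun m => hBad m))
    have : {x | x ∈ A ∧ c x = n} = ⋃ w, {x | x ∈ A ∧ r x = w ∧ c x = n} := by
      ext x
      simp
    rw [this]
    exact MeasurableSet.iUnion fun w => key w n

/-- The number of edges inside a set is bounded by the top of the spectrum. -/
theorem edgeMeasure_prod_self_le [StandardBorelSpace X] {μ : Measure X} [IsFiniteMeasure μ]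
    (hpmp : IsPMP G μ) (hV : μ Vᶜ = 0) {B : Set X} (hB : MeasurableSet B) :
    (D.edgeMeasure μ).real (B ×ˢ B) ≤ maxSpectralValue (D.operator hpmp hV) * μ.real B := by
  let f : Lp ℂ 2 μ := indicatorConstLp 2 hB (measure_ne_top μ B) 1
  have hf : f =ᵐ[μ] B.indicator fun _ => 1 := indicatorConstLp_coeFn
  have hf1 : (fun p : X × X => f p.1) =ᵐ[D.edgeMeasure μ] fun p => B.indicator (fun _ => 1) p.1 :=
    ae_of_ae_map measurable_fst.aemeasurable
      ((Measure.absolutelyContinuous_of_le_smul D.map_fst_edgeMeasure_le).ae_eq hf)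
  have hf2 : (fun p : X × X => f p.2) =ᵐ[D.edgeMeasure μ] fun p => B.indicator (fun _ => 1) p.2 :=
    ae_of_ae_map measurable_snd.aemeasurable
      ((Measure.absolutelyContinuous_of_le_smul (D.map_snd_edgeMeasure_le hpmp hV)).ae_eq hf)
  have hinner : inner ℂ (D.operator hpmp hV f) f = ((D.edgeMeasure μ).real (B ×ˢ B) : ℂ) := by
    rw [D.inner_operator_left]
    have : (fun p : X × X => inner ℂ (f p.2) (f p.1)) =ᵐ[D.edgeMeasure μ]
        (B ×ˢ B).indicator fun _ => (1 : ℂ) := by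
      filter_upwards [hf1, hf2] with p h1 h2
      rw [h1, h2]
      by_cases hp1 : p.1 ∈ B <;> by_cases hp2 : p.2 ∈ B <;> simp [hp1, hp2, indicator]
    rw [integral_congr_ae this, integral_indicator (hB.prod hB)]
    simp
  have hnorm : ‖f‖ ^ 2 = μ.real B := by
    rw [norm_indicatorConstLp (by simp) (by simp), norm_one, one_mul, ← Real.rpow_natCast,
      ← Real.rpow_mul measureReal_nonneg]
    simp
  have := re_inner_le_maxSpectralValue_mul (D.operator hpmp hV) f
  rwa [hinner, hnorm, Complex.ofReal_re] at this

end Enumeration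

end Coloring

/-! ### Peeling off vertices of low degree -/

section Peeling

open Set Filter Topology

variable {X : Type*} [MeasurableSpace X]

namespace Enumeration

variable {G : SimpleGraph X} {V : Set X} {d : ℕ} (D : Enumeration G V d)

/-- The indices of the neighbors of a vertex that lie in a given set. -/
def nbrsIn (B : Set X) (x : X) : Set (Fin d) := {i | x ∈ D.dom i ∧ D.nbr i x ∈ B}

theorem measurable_ncard_nbrsIn {B : Set X} (hB : MeasurableSet B) :
    Measurable fun x => (D.nbrsIn B x).ncard := by
  classical
  have : (fun x => (D.nbrsIn B x).ncard) = fun x =>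
      ∑ i, (D.dom i ∩ D.nbr i ⁻¹' B).indicator (fun _ => 1) x := by
    funext x
    rw [ncard_eq_toFinset_card']
    simp only [indicator_apply, Finset.sum_boole, Nat.cast_id]
    congr 1
    ext i
    rw [mem_toFinset]
    simp [nbrsIn]
  rw [this]
  exact Finset.measurable_sum _ fun i _ => measurable_const.indicator
    ((D.measurableSet_dom i).inter (D.measurable_nbr i hB))

theorem edgeMeasure_prod {μ : Measure X} {B C : Set X} (hB : MeasurableSet B)
    (hC : MeasurableSet C) :
    D.edgeMeasure μ (B ×ˢ C) = ∫⁻ x in B, (D.nbrsIn C x).ncard ∂μ := by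
  classical
  have h (x : X) : ((D.nbrsIn C x).ncard : ENNReal) =
      ∑ i, (D.dom i ∩ D.nbr i ⁻¹' C).indicator 1 x := by
    rw [ncard_eq_toFinset_card']
    simp only [indicator_apply, Pi.one_apply, Finset.sum_boole]
    congr 2
    ext i
    rw [mem_toFinset]
    simp [nbrsIn]
  have hm (i) : MeasurableSet (D.dom i ∩ D.nbr i ⁻¹' C) :=
    (D.measurableSet_dom i).inter (D.measurable_nbr i hC)
  simp only [h]
  rw [lintegral_finsetSum _ fun i _ => measurable_one.indicator (hm i),
    D.edgeMeasure_apply (hB.prod hC)]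
  refine Finset.sum_congr rfl fun i _ => ?_
  rw [lintegral_indicator_one (hm i), Measure.restrict_apply (hm i)]
  congr 1
  ext x
  simp only [mem_inter_iff, mem_preimage, mem_prod]
  tauto

/-- A set in which all the vertices have degree greater than `k` is null if `k + 1` exceeds the top
of the spectrum. -/
theorem measure_eq_zero_of_lt_ncard_nbrsIn [StandardBorelSpace X] {μ : Measure X}
    [IsFiniteMeasure μ] (hpmp : IsPMP G μ) (hV : μ Vᶜ = 0) {k : ℕ}
    (hk : maxSpectralValue (D.operator hpmp hV) < k + 1) {B : Set X} (hB : MeasurableSet B)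
    (hdeg : ∀ x ∈ B, k < (D.nbrsIn B x).ncard) : μ B = 0 := by
  have h1 : ((k + 1 : ℕ) : ENNReal) * μ B ≤ D.edgeMeasure μ (B ×ˢ B) := by
    rw [D.edgeMeasure_prod hB hB, ← setLIntegral_const]
    exact setLIntegral_mono' hB fun x hx => by exact_mod_cast hdeg x hx
  have hfin : D.edgeMeasure μ (B ×ˢ B) ≠ ⊤ := by
    have : IsFiniteMeasure (D.edgeMeasure μ) := by
      unfold edgeMeasure
      infer_instance
    exact measure_ne_top _ _
  have h2 := ENNReal.toReal_mono hfin h1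
  rw [ENNReal.toReal_mul, ENNReal.toReal_natCast] at h2
  have h3 := h2.trans (D.edgeMeasure_prod_self_le hpmp hV hB)
  by_contra hne
  have hpos : 0 < μ.real B := ENNReal.toReal_pos hne (measure_ne_top _ _)
  have h4 := lt_of_lt_of_le (mul_lt_mul_of_pos_right hk hpos) (by push_cast at h3; exact h3)
  exact lt_irrefl _ h4

/-- The sets obtained by repeatedly removing all vertices of degree at most `k`. -/
def peel (k : ℕ) : ℕ → Set X
  | 0 => V
  | n + 1 => {x | x ∈ peel k n ∧ k < (D.nbrsIn (peel k n) x).ncard}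

theorem measurableSet_peel (hV : MeasurableSet V) (k n : ℕ) : MeasurableSet (D.peel k n) := by
  induction n with
  | zero => exact hV
  | succ n ih =>
    exact ih.inter (measurableSet_lt measurable_const (D.measurable_ncard_nbrsIn ih))

theorem antitone_peel (k : ℕ) : Antitone (D.peel k) :=
  antitone_nat_of_succ_le fun _ _ hx => hx.1

/-- Each of the finitely many neighbors outside the intersection is removed at a finite stage. At a
stage `m` past all of these, the surviving neighbors of `x` are exactly those in the intersection,
and `x` survives stage `m + 1`. -/
theorem lt_ncard_nbrsIn_iInter_peel (k : ℕ) {x : X} (hx : x ∈ ⋂ n, D.peel k n) :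
    k < (D.nbrsIn (⋂ n, D.peel k n) x).ncard := by
  classical
  have h (i : Fin d) : ∃ n, D.nbr i x ∈ D.peel k n → D.nbr i x ∈ ⋂ n, D.peel k n := by
    by_cases hi : D.nbr i x ∈ ⋂ n, D.peel k n
    · exact ⟨0, fun _ => hi⟩
    · rw [mem_iInter, not_forall] at hi
      obtain ⟨n, hn⟩ := hi
      exact ⟨n, fun h => absurd h hn⟩
  choose N hN using h
  let m := Finset.univ.sup N
  refine (mem_iInter.1 hx (m + 1)).2.trans_le (ncard_le_ncard (fun i hi => ⟨hi.1, hN i ?_⟩)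
    (toFinite _))
  exact D.antitone_peel k (Finset.le_sup (Finset.mem_univ i)) hi.2

theorem tendsto_measure_peel [StandardBorelSpace X] {μ : Measure X} [IsFiniteMeasure μ]
    (hpmp : IsPMP G μ) (hVm : MeasurableSet V) (hV : μ Vᶜ = 0) {k : ℕ}
    (hk : maxSpectralValue (D.operator hpmp hV) < k + 1) :
    Tendsto (fun n => μ (D.peel k n)) atTop (𝓝 0) := by
  have hm (n) := D.measurableSet_peel hVm k n
  rw [← D.measure_eq_zero_of_lt_ncard_nbrsIn hpmp hV hk (MeasurableSet.iInter hm)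
    fun x hx => D.lt_ncard_nbrsIn_iInter_peel k hx]
  exact tendsto_measure_iInter_atTop (fun n => (hm n).nullMeasurableSet) (D.antitone_peel k)
    ⟨0, measure_ne_top _ _⟩

/-- The vertices that are removed after finitely many steps can be colored in reverse order. -/
theorem exists_coloring_diff_peel [StandardBorelSpace X] (hVm : MeasurableSet V) (k n : ℕ) :
    ∃ c : X → ℕ, (∀ x ∈ V \ D.peel k n, c x ≤ k) ∧
      (∀ x ∈ V \ D.peel k n, ∀ y ∈ V \ D.peel k n, G.Adj x y → c x ≠ c y) ∧
      ∀ m, MeasurableSet {x | x ∈ V \ D.peel k n ∧ c x = m} := by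
  classical
  obtain ⟨e, he, hne⟩ := D.exists_nat_coloring
  have hm (m) := D.measurableSet_peel hVm k m
  -- The last stage, up to `n`, that `x` survives.
  let l : X → ℕ := fun x => Nat.findGreatest (fun m => x ∈ D.peel k m) n
  have hl : Measurable l := measurable_findGreatest fun m _ => hm m
  have hle (x : X) : l x ≤ n := Nat.findGreatest_le n
  -- Subtracting from `n` puts later removals first; the countable coloring `e` separates adjacent
  -- vertices of the same layer.
  let r : X → ℕ ×ₗ ℕ := fun x => toLex (n - l x, e x)
  have hmem {x : X} (hx : x ∈ V) : x ∈ D.peel k (l x) :=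
    Nat.findGreatest_spec (P := fun m => x ∈ D.peel k m) (Nat.zero_le n) hx
  have hlow {x : X} (hx : x ∈ V \ D.peel k n) : (D.nbrsIn (D.peel k (l x)) x).ncard ≤ k := by
    have hlt : l x < n := lt_of_le_of_ne (hle x) fun h => hx.2 (h ▸ hmem hx.1)
    have hnot : x ∉ D.peel k (l x + 1) :=
      Nat.findGreatest_is_greatest (P := fun m => x ∈ D.peel k m) (Nat.lt_succ_self _) hlt
    by_contra h
    exact hnot ⟨hmem hx.1, not_le.1 h⟩
  have : Countable (ℕ ×ₗ ℕ) := ofLex.injective.countable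
  refine D.exists_greedy_coloring (hVm.diff (hm n)) sdiff_subset r (fun w => ?_) k ?_ ?_
  · have : r ⁻¹' {w} = {x | n - l x = (ofLex w).1} ∩ {x | e x = (ofLex w).2} := by
      ext x
      simp only [r, mem_preimage, mem_singleton_iff, mem_inter_iff, mem_ofPred_eq]
      rw [← ofLex_inj, ofLex_toLex, Prod.ext_iff]
    rw [this]
    exact ((measurable_const.sub hl) (measurableSet_singleton _)).inter
      (he (measurableSet_singleton _))
  · intro x _ i hi _ h
    exact hne i x hi (Prod.ext_iff.1 (toLex_inj.1 h)).2
  · intro x hx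
    refine le_trans (ncard_le_ncard (t := D.nbrsIn (D.peel k (l x)) x) (fun i hi => ⟨hi.1, ?_⟩)
      (toFinite _)) (hlow hx)
    have h1 : n - l (D.nbr i x) ≤ n - l x := by
      rcases Prod.Lex.lt_iff.1 hi.2.2 with h | h
      · exact h.le
      · exact h.1.le
    have h2 : l x ≤ l (D.nbr i x) := by
      have := hle x
      have := hle (D.nbr i x)
      omega
    exact D.antitone_peel k h2 (hmem hi.2.1.1)

theorem approxMeasurablyColorable [StandardBorelSpace X] {μ : Measure X} [IsProbabilityMeasure μ]
    (hpmp : IsPMP G μ) (hVm : MeasurableSet V) (hV : μ Vᶜ = 0) {k : ℕ}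
    (hk : maxSpectralValue (D.operator hpmp hV) < k + 1) :
    ApproxMeasurablyColorable G μ (k + 1) := by
  intro ε hε
  obtain ⟨n, hn⟩ := ((D.tendsto_measure_peel hpmp hVm hV hk).eventually
    (gt_mem_nhds (ENNReal.ofReal_pos.2 hε))).exists
  have hP := D.measurableSet_peel hVm k n
  obtain ⟨c, hck, hc, hcm⟩ := D.exists_coloring_diff_peel hVm k n
  refine ⟨V \ D.peel k n, hVm.diff hP, ?_, SimpleGraph.Coloring.mk
    (fun x => ⟨c x, Nat.lt_succ_of_le (hck x x.2)⟩) (fun {x y} hxy h => ?_), fun i => ?_⟩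
  · have h1 : μ.real V = 1 := by
      rw [← probReal_univ (μ := μ)]
      exact measureReal_congr (ae_eq_univ.2 hV)
    have h2 : μ.real (D.peel k n) < ε := by
      rw [measureReal_def]
      exact (ENNReal.toReal_lt_of_lt_ofReal hn)
    have hsub : D.peel k n ⊆ V := D.antitone_peel k (Nat.zero_le n)
    rw [measureReal_sdiff hsub hP, h1]
    linarith
  · exact hc x x.2 y y.2 hxy (Fin.ext_iff.1 h)
  · have : ((↑) '' {x : (V \ D.peel k n : Set X) | (⟨c x, Nat.lt_succ_of_le (hck x x.2)⟩ :
        Fin (k + 1)) = i} : Set X) = {x | x ∈ V \ D.peel k n ∧ c x = i} := by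
      ext x
      simp [Fin.ext_iff, and_comm]
    exact this ▸ (hcm i).nullMeasurableSet

end Enumeration

/-- The constant function `1` has nonnegative Rayleigh quotient. This identifies the natural-number
floor used in the coloring with the integer floor of the final bound. -/
theorem maxSpectralValue_operator_nonneg [StandardBorelSpace X] {G : SimpleGraph X} {V : Set X}
    {d : ℕ} (D : Enumeration G V d) {μ : Measure X} [IsProbabilityMeasure μ] (hpmp : IsPMP G μ)
    (hV : μ Vᶜ = 0) : 0 ≤ maxSpectralValue (D.operator hpmp hV) := by
  have h := D.edgeMeasure_prod_self_le hpmp hV MeasurableSet.univ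
  rw [probReal_univ, mul_one] at h
  exact measureReal_nonneg.trans h

end Peeling

end BorelGraph

/-! ### The main theorem -/

theorem theorem5p4 {X : Type*} [MeasurableSpace X] [StandardBorelSpace X]
    (μ : Measure X) [IsProbabilityMeasure μ] (G : SimpleGraph X)
    (hBorel : BorelGraph.IsBorel G) (hdeg : BorelGraph.HasBoundedDegree G μ)
    (hpmp : BorelGraph.IsPMP G μ) :
    -- the adjacency operator exists, is self-adjoint, and `M(T_G)` is the top of its spectrum
    BorelGraph.IsAdjacencyOperator G μ (BorelGraph.adjacencyOperator G μ) ∧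
    IsSelfAdjoint (BorelGraph.adjacencyOperator G μ) ∧
    IsGreatest {r : ℝ | (r : ℂ) ∈ spectrum ℂ (BorelGraph.adjacencyOperator G μ)}
      (BorelGraph.maxSpectralValue (BorelGraph.adjacencyOperator G μ)) ∧
    -- the approximate measurable chromatic number is finite and at most `⌊M(T_G)⌋ + 1`
    ∃ k : ℕ, BorelGraph.approxChromaticNumber G μ = k ∧
      (k : ℤ) ≤ ⌊BorelGraph.maxSpectralValue (BorelGraph.adjacencyOperator G μ)⌋ + 1 := by
  obtain ⟨V, d, hVm, hV, ⟨D⟩⟩ := BorelGraph.exists_enumeration hBorel hdeg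
  have hT := D.isAdjacencyOperator hpmp hV
  have hsa := D.isSelfAdjoint_operator hpmp hV
  -- On the zero space the spectrum would be empty; here the constant `1` has norm `1`.
  have : Nontrivial (Lp ℂ 2 μ) := by
    refine ⟨⟨indicatorConstLp 2 MeasurableSet.univ (measure_ne_top μ _) 1, 0, fun h => ?_⟩⟩
    have := congrArg norm h
    rw [norm_indicatorConstLp (by simp) (by simp)] at this
    simp at this
  rw [hT.eq_adjacencyOperator]
  refine ⟨hT, hsa, BorelGraph.maxSpectralValue_isGreatest_spectrum hsa, ?_⟩
  have hpos := BorelGraph.maxSpectralValue_operator_nonneg D hpmp hV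
  have hcol := D.approxMeasurablyColorable hpmp hVm hV (Nat.lt_floor_add_one _)
  have hle : BorelGraph.approxChromaticNumber G μ ≤
      (⌊BorelGraph.maxSpectralValue (D.operator hpmp hV)⌋₊ + 1 : ℕ) :=
    iInf₂_le (f := fun (k : ℕ) (_ : k ∈ {k | BorelGraph.ApproxMeasurablyColorable G μ k}) =>
      (k : ℕ∞)) _ hcol
  obtain ⟨k, hk⟩ := ENat.ne_top_iff_exists.1 (ne_top_of_le_ne_top (ENat.natCast_ne_top _) hle)
  refine ⟨k, hk.symm, ?_⟩
  rw [← hk, ENat.natCast_le_natCast] at hle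
  rw [← Int.natCast_floor_eq_floor hpos]
  exact_mod_cast hle
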